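/- For a real number $a>0$ with $a\neq 1$ let $B_a=\{\sum_i m_i a^{n_i}\ \text{(finite sums)} : m_i,n_i\in\mathbb Z\}\subset\mathbb R$, regarded as a discrete abelian group, let $\alpha_a$ be the automorphism $b\mapsto ab$ of $B_a$, let $G_a=B_a\rtimes_{\alpha_a}\mathbb Z$ (where $n\in\mathbb Z$ acts by $b\mapsto a^n b$), and let $\mathcal U_a=C^*(G_a)$ be the full group $C^*$-algebra of the discrete group $G_a$. Let $\widehat{B_a}$ be the (compact) Pontryagin dual of $B_a$ and $\widehat{\alpha_a}:\chi\mapsto\chi\circ\alpha_a$ the dual automorphism. For $q\ge 1$ put $$\mathrm{Per}_q(a)=\{\chi\in\widehat{B_a} : \widehat{\alpha_a}^{\,k}(\chi)\neq\chi\ \text{for } 0<k<q,\ \ \widehat{\alpha_a}^{\,q}(\chi)=\chi\},\qquad \mathrm{Fix}_q(a)=\{\chi\in\widehat{B_a} : \widehat{\alpha_a}^{\,q}(\chi)=\chi\},$$ and let $h(\widehat{\alpha_a})\in[0,\infty]$ be the topological entropy of $\widehat{\alpha_a}$. **Theorem 3.3.** Let $a,a'>0$ be real numbers different from $1$ such that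 $\mathcal U_a$ and $\mathcal U_{a'}$ are isomorphic as $C^*$-algebras. Then: (i) for every integer $q\ge 1$, the numbers of $q$-periodic points agree in $\mathbb N\cup\{\infty\}$, both for points of exact period $q$ and for points fixed by the $q$-th iterate: $\#\mathrm{Per}_q(a)=\#\mathrm{Per}_q(a')$ and $\#\mathrm{Fix}_q(a)=\#\mathrm{Fix}_q(a')$; (ii) $h(\widehat{\alpha_a})=h(\widehat{\alpha_{a'}})$; that is, the topological entropy of the dual automorphism is an isomorphism invariant of $\mathcal U_a$. -/

import Mathlib

open scoped ENNReal

noncomputable section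

namespace KappaMinkowski

/-! ### The full group C⋆-algebra of a discrete group -/

/-- A unitary representation of the (discrete) group `G` on a nonzero complex Hilbert space. Hilbert
spaces in `Type` suffice for groups in `Type`, as every representation is a direct sum of cyclic
ones and a cyclic one has a dense subset indexed by finitely supported functions on `G`. -/
structure UnitaryRep (G : Type) [Group G] : Type 1 where
  /-- the Hilbert space of the representation -/
  H : Type
  [normedAddCommGroup : NormedAddCommGroup H]
  [innerProductSpace : InnerProductSpace ℂ H]
  [completeSpace : CompleteSpace H]
  [nontrivial : Nontrivial H]
  /-- the action by unitary operators -/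
  toHom : G →* unitary (H →L[ℂ] H)

attribute [instance] UnitaryRep.normedAddCommGroup UnitaryRep.innerProductSpace
  UnitaryRep.completeSpace UnitaryRep.nontrivial

/-- The C⋆-algebra of bounded families of operators `(T_π)_π`, one on the space of each unitary
representation `π` of `G`, with pointwise operations and the norm `sup_π ‖T_π‖`. -/
abbrev RepFamilies (G : Type) [Group G] : Type 1 :=
  lp (fun π : UnitaryRep G => π.H →L[ℂ] π.H) ∞

/-- The canonical unitary of `g`: the family `(π(g))_π`. -/
def canonicalUnitary {G : Type} [Group G] (g : G) : RepFamilies G :=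
  ⟨fun π => ((π.toHom g : unitary (π.H →L[ℂ] π.H)) : π.H →L[ℂ] π.H), by
    refine memℓp_infty ⟨1, ?_⟩
    rintro _ ⟨π, rfl⟩
    exact CStarRing.norm_of_mem_unitary (π.toHom g).2 |>.le⟩

/-- The full group C⋆-algebra `C⋆(G)`: the norm closure of the ⋆-algebra spanned by the canonical
unitaries, i.e. the completion of (the image of) the group algebra `ℂ[G]` for the norm
`‖f‖ = sup_π ‖π(f)‖` over all unitary representations `π` of `G`. -/
def groupCStar (G : Type) [Group G] : StarSubalgebra ℂ (RepFamilies G) :=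
  (StarAlgebra.adjoin ℂ (Set.range (canonicalUnitary (G := G)))).topologicalClosure

/-! ### The groups `B_a`, `G_a` and the algebra `𝒰_a` -/

/-- Positive real numbers, the possible labels `a`. -/
abbrev Label : Type := {a : ℝ // 0 < a}

/-- The additive subgroup `{∑ mᵢ a ^ nᵢ (finite sums) : mᵢ, nᵢ ∈ ℤ}` of `ℝ`. -/
def latticeSubgroup (a : Label) : AddSubgroup ℝ where
  carrier := {b | ∃ m : ℤ →₀ ℤ, b = m.sum fun n k => (k : ℝ) * (a : ℝ) ^ n}
  zero_mem' := ⟨0, by simp⟩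
  add_mem' := by
    rintro _ _ ⟨m, rfl⟩ ⟨m', rfl⟩
    refine ⟨m + m', ?_⟩
    rw [Finsupp.sum_add_index'] <;> simp [add_mul]
  neg_mem' := by
    rintro _ ⟨m, rfl⟩
    refine ⟨-m, ?_⟩
    rw [Finsupp.sum_neg_index] <;> simp [Finsupp.sum]

/-- The abstract group `B_a` (a type of its own, so as not to inherit the topology of `ℝ`). -/
def B (a : Label) : Type := latticeSubgroup a

instance (a : Label) : AddCommGroup (B a) := inferInstanceAs (AddCommGroup (latticeSubgroup a))

/-- `B_a` carries the discrete topology. -/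
instance (a : Label) : TopologicalSpace (B a) := ⊥

instance (a : Label) : DiscreteTopology (B a) := ⟨rfl⟩

theorem mul_zpow_mem (a : Label) (j : ℤ) {b : ℝ} (hb : b ∈ latticeSubgroup a) :
    (a : ℝ) ^ j * b ∈ latticeSubgroup a := by
  obtain ⟨m, rfl⟩ := hb
  refine ⟨m.mapDomain (j + ·), ?_⟩
  rw [Finsupp.sum_mapDomain_index (by simp) (by intros; push_cast; ring), Finsupp.mul_sum]
  refine Finsupp.sum_congr fun n _ => ?_
  rw [zpow_add₀ a.2.ne']
  ring

/-- The automorphism `α_a` of `B_a`: multiplication by `a`. -/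
def mulAut (a : Label) : B a ≃+ B a where
  toFun b := ⟨(a : ℝ) * b.1, by simpa using mul_zpow_mem a 1 b.2⟩
  invFun b := ⟨(a : ℝ)⁻¹ * b.1, by simpa using mul_zpow_mem a (-1) b.2⟩
  left_inv b := Subtype.ext (inv_mul_cancel_left₀ a.2.ne' b.1)
  right_inv b := Subtype.ext (mul_inv_cancel_left₀ a.2.ne' b.1)
  map_add' b b' := Subtype.ext (mul_add (a : ℝ) b.1 b'.1)

/-- The action of `ℤ` on `B_a` by powers of `α_a`, that is `α_a(n) b = a ^ n * b`. -/
def action (a : Label) : Multiplicative ℤ →* MulAut (Multiplicative (B a)) :=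
  zpowersHom _ (AddEquiv.toMultiplicative (mulAut a))

/-- The (discrete) group `G_a = B_a ⋊ ℤ`. -/
abbrev G (a : Label) : Type := Multiplicative (B a) ⋊[action a] Multiplicative ℤ

/-- The algebra `𝒰_a = C⋆(G_a)`. -/
abbrev U (a : Label) : Type 1 := groupCStar (G a)

/-! ### The dual dynamical system -/

/-- The compact group `B̂_a`, the Pontryagin dual of the discrete group `B_a`. -/
abbrev dualGroup (a : Label) : Type := PontryaginDual (Multiplicative (B a))

/-- The automorphism `α̂_a` of `B̂_a` dual to `α_a`: `χ ↦ χ ∘ α_a`. -/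
def dualAut (a : Label) : dualGroup a ≃ₜ* dualGroup a where
  toFun := PontryaginDual.map
    ⟨(AddEquiv.toMultiplicative (mulAut a)).toMonoidHom, continuous_of_discreteTopology⟩
  invFun := PontryaginDual.map
    ⟨(AddEquiv.toMultiplicative (mulAut a)).symm.toMonoidHom, continuous_of_discreteTopology⟩
  left_inv χ := PontryaginDual.ext fun b =>
    congrArg χ ((AddEquiv.toMultiplicative (mulAut a)).apply_symm_apply b)
  right_inv χ := PontryaginDual.ext fun b =>
    congrArg χ ((AddEquiv.toMultiplicative (mulAut a)).symm_apply_apply b)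
  map_mul' := map_mul _
  continuous_toFun := ContinuousMonoidHom.continuous_toFun _
  continuous_invFun := ContinuousMonoidHom.continuous_toFun _

/-- The set `Per_q(B̂_a)` of points of exact period `q`:
`α̂^k χ ≠ χ` for `0 < k < q` and `α̂^q χ = χ`. -/
def Per (q : ℕ) (a : Label) : Set (dualGroup a) :=
  {χ | (∀ k : ℕ, 0 < k → k < q → (dualAut a)^[k] χ ≠ χ) ∧ (dualAut a)^[q] χ = χ}

/-- The set of points fixed by `α̂^q`, i.e. whose exact period divides `q`. -/
def PerDvd (q : ℕ) (a : Label) : Set (dualGroup a) :=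
  {χ | (dualAut a)^[q] χ = χ}

/-- The topological entropy `h(α̂_a) ∈ [0, ∞]` of the homeomorphism `α̂_a` of the compact group
`B̂_a` (with its unique compatible uniform structure). -/
def entropy (a : Label) : EReal :=
  letI : UniformSpace (dualGroup a) := IsTopologicalGroup.rightUniformSpace (dualGroup a)
  Dynamics.coverEntropy (dualAut a) Set.univ

end KappaMinkowski

end

noncomputable section

namespace KappaMinkowski

open Polynomial

/-! ### Polynomials in the shift operator -/

/-! Periodic points of `α̂_a` are visible in the finite-dimensional irreducible representations of
`𝒰_a`. In such a representation `B_a` is diagonalised by characters which the generator of `ℤ`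
permutes through `α̂_a`. Irreducibility leaves a single orbit of some exact period `q`, and the only
further datum is a phase `ζ` on the circle (`exists_equiv_cyclicRep`). The traces of the
`q`-dimensional irreducible representations, with pointwise convergence, form a space intrinsic to
the algebra. If `Per q a` is finite, this space splits into one connected image of the circle per
orbit, so its number of components times `q` is the number of points of exact period `q`
(`ncard_Per_eq_card_connectedComponents`). Summing over divisors counts the points fixed by the
`q`-th iterate.

For algebraic `a ≠ 1` the entropy is determined by these numbers. Let `f` be the primitive integral
polynomial of `a`. The dual of `B_a` consists of the circle-valued sequences killed by `f(shift)`.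
No root of `f` is a root of unity, so `f(shift)` is invertible on `n`-periodic real sequences, with
an explicit bound for the inverse. This makes the points of period `n` finite in number and
uniformly separated, so they bound the entropy from below. It also lets any orbit segment be
shadowed by a periodic point up to polynomially many choices, for infinitely many `n`, which gives
the upper bound. Hence the entropy is the exponential growth rate of the number of periodic points
(`IsDefining.entropy_eq_expGrowthSup`).

For transcendental `a` the system is the full shift over the circle, so two such labels have
conjugate systems whether or not the algebras are isomorphic. An isomorphism cannot mix the two
kinds of label: the space of one-dimensional traces contains an injective continuous image of the
plane in the transcendental case, but not in the algebraic one (`not_transcendental_of_isDefining`).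
-/

/-- The shift `w ↦ w (· + 1)` on functions on `I`. -/
def shift (R I : Type*) [CommSemiring R] [AddMonoidWithOne I] : Module.End R (I → R) :=
  LinearMap.funLeft R R (· + 1)

section Shift

variable {R I : Type*} [CommRing R] [AddMonoidWithOne I]

theorem shift_apply (w : I → R) (k : I) : shift R I w k = w (k + 1) := rfl

theorem shift_pow_apply (m : ℕ) (w : I → R) (k : I) : (shift R I ^ m) w k = w (k + m) := by
  induction m generalizing k with
  | zero => simp
  | succ m ih =>
    rw [pow_succ', Module.End.mul_apply, shift_apply, ih, add_assoc, add_comm m 1,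
      Nat.cast_add, Nat.cast_one]

theorem aeval_shift_apply (p : ℤ[X]) (w : I → R) (k : I) :
    aeval (shift R I) p w k = ∑ i ∈ Finset.range (p.natDegree + 1), p.coeff i * w (k + i) := by
  simp [aeval_eq_sum_range, LinearMap.sum_apply, Finset.sum_apply, shift_pow_apply]

end Shift

/-! ### A priori bounds for periodic sequences -/

/-- With `y = (shift - z) x`, the recursion `x (k + 1) = z * x k + y k` run `n` times returns to `x
k` by periodicity, so `(1 - z ^ n) * x k` is a geometric combination of values of `y`. -/
theorem norm_mul_norm_one_sub_pow_le {n : ℕ} [NeZero n] (z : ℂ) (x : ZMod n → ℂ) :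
    ‖x‖ * ‖1 - z ^ n‖ ≤ ‖aeval (shift ℂ (ZMod n)) (X - C z) x‖ * ∑ j ∈ Finset.range n, ‖z‖ ^ j := by
  set y := aeval (shift ℂ (ZMod n)) (X - C z) x with hy
  have hstep : ∀ k, x (k + 1) = z * x k + y k := fun k => by
    simp [hy, shift_apply]
  have key : ∀ (k : ZMod n) (m : ℕ),
      ‖x (k + m) - z ^ m * x k‖ ≤ ‖y‖ * ∑ j ∈ Finset.range m, ‖z‖ ^ j := by
    intro k m
    induction m with
    | zero => simp
    | succ m ih =>
      have : x (k + (m + 1 : ℕ)) - z ^ (m + 1) * x k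
          = z * (x (k + m) - z ^ m * x k) + y (k + m) := by
        rw [Nat.cast_succ, ← add_assoc, hstep]; ring
      rw [this, Finset.sum_range_succ', pow_zero, mul_add, mul_one]
      refine (norm_add_le _ _).trans (add_le_add ?_ (norm_le_pi_norm y _))
      rw [norm_mul]
      calc ‖z‖ * ‖x (k + m) - z ^ m * x k‖ ≤ ‖z‖ * (‖y‖ * ∑ j ∈ Finset.range m, ‖z‖ ^ j) := by gcongr
        _ = _ := by simp only [pow_succ, ← Finset.sum_mul]; ring
  rw [mul_comm, ← norm_smul]
  refine (pi_norm_le_iff_of_nonneg (by positivity)).2 fun k => ?_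
  have := key k n
  rw [ZMod.natCast_self, add_zero] at this
  refine le_trans (le_of_eq ?_) this
  simp only [Pi.smul_apply, smul_eq_mul]
  congr 1; ring

theorem norm_le_norm_aeval_shift_prod {n : ℕ} [NeZero n] {K : ℝ} (hK : 0 ≤ K) (s : Multiset ℂ)
    (hs : ∀ z ∈ s, z ^ n ≠ 1 ∧ ∑ j ∈ Finset.range n, ‖z‖ ^ j ≤ K * ‖1 - z ^ n‖) (x : ZMod n → ℂ) :
    ‖x‖ ≤ K ^ s.card * ‖aeval (shift ℂ (ZMod n)) (s.map fun z => X - C z).prod x‖ := by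
  induction s using Multiset.induction generalizing x with
  | empty => simp
  | cons z s ih =>
    have hz := hs z (Multiset.mem_cons_self z s)
    have h1 := ih (fun w hw => hs w (Multiset.mem_cons_of_mem hw)) x
    set y := aeval (shift ℂ (ZMod n)) (s.map fun z => X - C z).prod x
    have h2 := norm_mul_norm_one_sub_pow_le z y
    rw [Multiset.map_cons, Multiset.prod_cons, map_mul, Module.End.mul_apply, Multiset.card_cons]
    have hpos : 0 < ‖1 - z ^ n‖ := norm_pos_iff.2 (sub_ne_zero.2 (Ne.symm hz.1))
    have h3 : ‖y‖ ≤ K * ‖aeval (shift ℂ (ZMod n)) (X - C z) y‖ := by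
      refine le_of_mul_le_mul_right (h2.trans ?_) hpos
      calc _ ≤ ‖aeval (shift ℂ (ZMod n)) (X - C z) y‖ * (K * ‖1 - z ^ n‖) := by gcongr; exact hz.2
        _ = _ := by ring
    calc ‖x‖ ≤ K ^ s.card * ‖y‖ := h1
      _ ≤ K ^ s.card * (K * ‖aeval (shift ℂ (ZMod n)) (X - C z) y‖) := by gcongr
      _ = _ := by ring

/-- Each linear factor over `ℂ` costs one factor `K`. The leading coefficient is a nonzero integer,
of absolute value at least one, and can be dropped. -/
theorem norm_le_norm_aeval_shift {n : ℕ} [NeZero n] {K : ℝ} (hK : 0 ≤ K) {f : ℤ[X]} (hf : f ≠ 0)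
    (hs : ∀ z ∈ (f.map (Int.castRingHom ℂ)).roots,
      z ^ n ≠ 1 ∧ ∑ j ∈ Finset.range n, ‖z‖ ^ j ≤ K * ‖1 - z ^ n‖) (x : ZMod n → ℂ) :
    ‖x‖ ≤ K ^ f.natDegree * ‖aeval (shift ℂ (ZMod n)) f x‖ := by
  have hinj : Function.Injective (Int.castRingHom ℂ) := Int.cast_injective
  have hsplit := IsAlgClosed.splits (f.map (Int.castRingHom ℂ))
  have hcard := hsplit.natDegree_eq_card_roots
  rw [natDegree_map_eq_of_injective hinj] at hcard
  have hlead : 1 ≤ ‖(f.map (Int.castRingHom ℂ)).leadingCoeff‖ := by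
    rw [leadingCoeff_map_of_injective hinj, eq_intCast, Complex.norm_intCast]
    exact_mod_cast Int.one_le_abs (leadingCoeff_ne_zero.2 hf)
  have h1 := norm_le_norm_aeval_shift_prod hK _ hs x
  rw [hcard]
  refine h1.trans ?_
  gcongr
  rw [← aeval_map_algebraMap ℂ (shift ℂ (ZMod n)) f, algebraMap_int_eq]
  conv_rhs => rw [hsplit.eq_prod_roots]
  rw [map_mul, aeval_C, Module.End.mul_apply, Module.algebraMap_end_apply, norm_smul]
  exact le_mul_of_one_le_left (norm_nonneg _) hlead

theorem norm_le_norm_aeval_shift_real {n : ℕ} [NeZero n] {K : ℝ} (hK : 0 ≤ K) {f : ℤ[X]}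
    (hf : f ≠ 0) (hs : ∀ z ∈ (f.map (Int.castRingHom ℂ)).roots,
      z ^ n ≠ 1 ∧ ∑ j ∈ Finset.range n, ‖z‖ ^ j ≤ K * ‖1 - z ^ n‖) (x : ZMod n → ℝ) :
    ‖x‖ ≤ K ^ f.natDegree * ‖aeval (shift ℝ (ZMod n)) f x‖ := by
  have h := norm_le_norm_aeval_shift hK hf hs fun k => (x k : ℂ)
  have h1 : aeval (shift ℂ (ZMod n)) f (fun k => (x k : ℂ))
      = fun k => ((aeval (shift ℝ (ZMod n)) f x k : ℝ) : ℂ) := by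
    funext k
    simp [aeval_shift_apply]
  have h2 : ∀ y : ZMod n → ℝ, ‖fun k => (y k : ℂ)‖ = ‖y‖ := fun y => by
    simp [Pi.norm_def, nnnorm, Real.norm_eq_abs]
  rwa [h1, h2, h2] at h

/-! ### Times at which powers of given numbers stay away from one -/

theorem exists_pos_forall_le_of_finset {ι : Type*} (s : Finset ι) (f : ι → ℝ)
    (hf : ∀ i ∈ s, 0 < f i) : ∃ c > 0, ∀ i ∈ s, c ≤ f i := by
  classical
  induction s using Finset.induction with
  | empty => exact ⟨1, one_pos, by simp⟩
  | insert i s _ ih =>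
    obtain ⟨c, hc, h⟩ := ih fun j hj => hf j (Finset.mem_insert_of_mem hj)
    refine ⟨min c (f i), lt_min hc (hf i (Finset.mem_insert_self i s)), fun j hj => ?_⟩
    obtain rfl | hj := Finset.mem_insert.1 hj
    · exact min_le_right _ _
    · exact (min_le_left _ _).trans (h j hj)

/-- A pigeonhole argument, in place of Diophantine estimates. If at each of `s.card + 1` consecutive
times some element of `s` had its power within `c / 2` of `1`, one `z` would serve at two times `i <
j`, and `z ^ (j - i)` would be closer to `1` than the minimum `c` over exponents up to `s.card`. -/
theorem exists_forall_le_norm_one_sub_pow (s : Finset ℂ) (h1 : ∀ z ∈ s, ‖z‖ = 1)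
    (hs : ∀ z ∈ s, ∀ n : ℕ, 0 < n → z ^ n ≠ 1) :
    ∃ c > 0, ∀ n₀ : ℕ, ∃ n ≥ n₀, ∀ z ∈ s, c ≤ ‖1 - z ^ n‖ := by
  obtain ⟨c, hc, h⟩ := exists_pos_forall_le_of_finset (s ×ˢ Finset.Icc 1 s.card)
    (fun p => ‖1 - p.1 ^ p.2‖) (fun p hp => by
      rw [Finset.mem_product, Finset.mem_Icc] at hp
      exact norm_pos_iff.2 (sub_ne_zero.2 (Ne.symm (hs _ hp.1 _ hp.2.1))))
  refine ⟨c / 2, half_pos hc, fun n₀ => ?_⟩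
  by_contra! hbad
  choose! b hb hb' using fun i : ℕ => hbad (n₀ + i) (Nat.le_add_right _ _)
  have aux : ∀ i j : ℕ, i < j → j ≤ s.card → b i ≠ b j := by
    intro i j hij hj hbij
    have h2 := h (b i, j - i) (by
      rw [Finset.mem_product, Finset.mem_Icc]
      exact ⟨hb i, by dsimp only; omega, by dsimp only; omega⟩)
    have h3 := hb' i
    have h4 := hb' j
    rw [← hbij] at h4
    have h5 : ‖(1 - b i ^ (j - i))‖ = ‖(1 - b i ^ (n₀ + j)) - (1 - b i ^ (n₀ + i))‖ := by
      have : (1 - b i ^ (n₀ + j)) - (1 - b i ^ (n₀ + i)) = b i ^ (n₀ + i) * (1 - b i ^ (j - i)) := by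
        rw [mul_sub, ← pow_add, show n₀ + i + (j - i) = n₀ + j by omega]; ring
      rw [this, norm_mul, norm_pow, h1 _ (hb i), one_pow, one_mul]
    have h6 := norm_sub_le (1 - b i ^ (n₀ + j)) (1 - b i ^ (n₀ + i))
    simp only at h2
    linarith
  obtain ⟨i, hi, j, hj, hij, hbij⟩ := Finset.exists_ne_map_eq_of_card_lt_of_maps_to
    (s := Finset.range (s.card + 1)) (t := s) (by simp) (f := b) (fun i _ => hb i)
  rw [Finset.mem_range] at hi hj
  rcases lt_or_gt_of_ne hij with hlt | hlt
  · exact aux i j hlt (by omega) hbij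
  · exact aux j i hlt (by omega) hbij.symm

/-- Inside the unit disc `‖1 - z ^ n‖` is at least `1 - ‖z‖`; outside, it dominates the geometric
sum up to a constant. Only on the circle is `c` needed, and there the sum is exactly `n`. -/
theorem exists_sum_norm_pow_le (z : ℂ) {c : ℝ} (hc : 0 < c) : ∃ K : ℝ, ∀ n : ℕ, 0 < n →
    (‖z‖ = 1 → c ≤ ‖1 - z ^ n‖) → ∑ j ∈ Finset.range n, ‖z‖ ^ j ≤ K * n * ‖1 - z ^ n‖ := by
  rcases lt_trichotomy ‖z‖ 1 with h | h | h
  · refine ⟨1 / (1 - ‖z‖), fun n hn _ => ?_⟩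
    have h1 : ∑ j ∈ Finset.range n, ‖z‖ ^ j ≤ n := by
      simpa using Finset.sum_le_card_nsmul (Finset.range n) (fun j => ‖z‖ ^ j) 1
        fun j _ => pow_le_one₀ (norm_nonneg z) h.le
    have h2 : 1 - ‖z‖ ≤ ‖1 - z ^ n‖ := by
      have h3 := norm_sub_norm_le 1 (z ^ n)
      rw [norm_one, norm_pow] at h3
      have h4 : ‖z‖ ^ n ≤ ‖z‖ := pow_le_of_le_one (norm_nonneg z) h.le hn.ne'
      linarith
    have h5 : 0 < 1 - ‖z‖ := by linarith
    calc _ ≤ (n : ℝ) := h1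
      _ = 1 / (1 - ‖z‖) * n * (1 - ‖z‖) := by field_simp
      _ ≤ _ := by gcongr
  · refine ⟨1 / c, fun n hn h2 => ?_⟩
    simp only [h, one_pow, Finset.sum_const, Finset.card_range, nsmul_eq_mul, mul_one]
    calc (n : ℝ) = 1 / c * n * c := by field_simp
      _ ≤ _ := by gcongr; exact h2 h
  · refine ⟨1 / (‖z‖ - 1), fun n hn _ => ?_⟩
    have h5 : 0 < ‖z‖ - 1 := by linarith
    rw [geom_sum_eq h.ne']
    have h3 := norm_sub_norm_le (z ^ n) 1
    rw [norm_one, norm_pow, norm_sub_rev] at h3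
    have h6 : (1 : ℝ) ≤ n := by exact_mod_cast hn
    calc (‖z‖ ^ n - 1) / (‖z‖ - 1) ≤ ‖1 - z ^ n‖ / (‖z‖ - 1) := by gcongr
      _ = 1 / (‖z‖ - 1) * 1 * ‖1 - z ^ n‖ := by ring
      _ ≤ _ := by gcongr

theorem exists_frequently_sum_norm_pow_le (s : Finset ℂ)
    (hs : ∀ z ∈ s, ∀ n : ℕ, 0 < n → z ^ n ≠ 1) :
    ∃ K : ℝ, 0 ≤ K ∧ ∀ n₀ : ℕ, ∃ n ≥ n₀, ∀ z ∈ s,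
      ∑ j ∈ Finset.range n, ‖z‖ ^ j ≤ K * n * ‖1 - z ^ n‖ := by
  classical
  obtain ⟨c, hc, h⟩ := exists_forall_le_norm_one_sub_pow (s.filter (‖·‖ = 1))
    (fun z hz => (Finset.mem_filter.1 hz).2) (fun z hz => hs z (Finset.mem_filter.1 hz).1)
  choose K hK using fun z : ℂ => exists_sum_norm_pow_le z hc
  obtain ⟨M, hM⟩ := (insert 0 (s.image K)).exists_le
  refine ⟨M, hM 0 (Finset.mem_insert_self _ _), fun n₀ => ?_⟩
  obtain ⟨n, hn, h'⟩ := h (n₀ + 1)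
  refine ⟨n, by omega, fun z hz => (hK z n (by omega) fun h1 =>
    h' z (Finset.mem_filter.2 ⟨hz, h1⟩)).trans ?_⟩
  gcongr
  exact hM _ (Finset.mem_insert_of_mem (Finset.mem_image_of_mem K hz))

/-! ### The primitive integral polynomial of an algebraic number -/

/-- By Gauss's lemma an irreducible integral factor vanishing at `x` stays irreducible over `ℚ`, so
it is associated to the minimal polynomial; primitivity brings divisibility back to `ℤ[X]`.
Divisibility over `ℤ` is what later turns integrality of `f(shift) w` into a character. -/
theorem exists_irreducible_forall_dvd {x : ℝ} (hx : IsAlgebraic ℤ x) :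
    ∃ f : ℤ[X], Irreducible f ∧ f.IsPrimitive ∧ aeval x f = 0 ∧
      ∀ g : ℤ[X], aeval x g = 0 → f ∣ g := by
  obtain ⟨p, hp0, hp⟩ := hx
  obtain ⟨s, hs, u, hu⟩ := WfDvdMonoid.exists_factors p hp0
  have hprod : aeval x s.prod = 0 := by
    rw [← hu, map_mul] at hp
    exact (mul_eq_zero.1 hp).resolve_right ((u.isUnit.map (aeval x)).ne_zero)
  rw [map_multiset_prod, Multiset.prod_eq_zero_iff, Multiset.mem_map] at hprod
  obtain ⟨f, hfs, hf⟩ := hprod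
  have hirr := hs f hfs
  have hdeg : f.natDegree ≠ 0 := fun h => by
    rw [eq_C_of_natDegree_eq_zero h, aeval_C] at hf
    have h0 : f.coeff 0 = 0 := by simpa using hf
    apply hirr.ne_zero
    rw [eq_C_of_natDegree_eq_zero h, h0, C_0]
  have hprim := hirr.isPrimitive hdeg
  refine ⟨f, hirr, hprim, hf, fun g hg => ?_⟩
  rw [IsPrimitive.Int.dvd_iff_map_cast_dvd_map_cast _ _ hprim]
  have hq : ∀ g : ℤ[X], aeval x g = 0 → minpoly ℚ x ∣ g.map (Int.castRingHom ℚ) := fun g hg => by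
    refine minpoly.dvd ℚ x ?_
    rwa [← algebraMap_int_eq, aeval_map_algebraMap]
  have hirrQ := (IsPrimitive.Int.irreducible_iff_irreducible_map_cast hprim).1 hirr
  have hassoc := (minpoly.irreducible (isAlgebraic_iff_isIntegral.1
    ⟨_, hirrQ.ne_zero, by rwa [← algebraMap_int_eq, aeval_map_algebraMap]⟩ :
      IsIntegral ℚ x)).associated_of_dvd hirrQ (hq f hf)
  exact hassoc.symm.dvd.trans (hq g hg)

/-- Over `ℚ`, an irreducible `f` sharing a root with `X ^ n - 1` divides it. Then `x` would satisfy
`x ^ n = 1`, impossible for a positive `x ≠ 1`. Conjugates on the unit circle remain possible. -/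
theorem pow_ne_one_of_mem_roots {x : ℝ} (hx : 0 < x) (hx1 : x ≠ 1) {f : ℤ[X]} (hirr : Irreducible f)
    (hprim : f.IsPrimitive) (hf : aeval x f = 0) {z : ℂ}
    (hz : z ∈ (f.map (Int.castRingHom ℂ)).roots) {n : ℕ} (hn : 0 < n) : z ^ n ≠ 1 := by
  intro hzn
  have hirrQ := (IsPrimitive.Int.irreducible_iff_irreducible_map_cast hprim).1 hirr
  have hndvd : ¬ f.map (Int.castRingHom ℚ) ∣ X ^ n - 1 := by
    rintro ⟨g, hg⟩
    have h1 : aeval x (f.map (Int.castRingHom ℚ)) = 0 := by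
      rwa [← algebraMap_int_eq, aeval_map_algebraMap]
    have h2 : aeval x (X ^ n - 1 : ℚ[X]) = 0 := by rw [hg, map_mul, h1, zero_mul]
    simp only [map_sub, map_pow, aeval_X, map_one, sub_eq_zero] at h2
    exact hx1 ((pow_eq_one_iff_of_nonneg hx.le hn.ne').1 h2)
  obtain ⟨u, v, huv⟩ := (hirrQ.coprime_iff_not_dvd).2 hndvd
  have hz0 : aeval z (f.map (Int.castRingHom ℚ)) = 0 := by
    rw [← algebraMap_int_eq, aeval_map_algebraMap, ← eval_map_algebraMap]
    exact (mem_roots'.1 hz).2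
  have := congrArg (aeval z) huv
  simp [hz0, hzn] at this

theorem exists_int_aeval_shift_mul {I : Type*} [AddMonoidWithOne I] {f : ℤ[X]} {w : I → ℝ}
    (hw : ∀ k, ∃ j : ℤ, aeval (shift ℝ I) f w k = j) (h : ℤ[X]) (k : I) :
    ∃ j : ℤ, aeval (shift ℝ I) (f * h) w k = j := by
  choose j hj using hw
  rw [mul_comm, map_mul, Module.End.mul_apply, aeval_shift_apply]
  exact ⟨∑ i ∈ Finset.range (h.natDegree + 1), h.coeff i * j (k + i), by simp [hj]⟩

/-! ### Laurent polynomials and the group `B_a` -/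

/-- Evaluation at `a` of a Laurent polynomial with integer coefficients. -/
def evalHom (a : Label) : (ℤ →₀ ℤ) →+ B a where
  toFun m := ⟨m.sum fun n k => (k : ℝ) * (a : ℝ) ^ n, m, rfl⟩
  map_zero' := Subtype.ext (by simp; rfl)
  map_add' m m' := Subtype.ext
    (Finsupp.sum_add_index' (h := fun (n k : ℤ) => (k : ℝ) * (a : ℝ) ^ n) (by simp)
      (by intros; push_cast; ring))

theorem evalHom_surjective (a : Label) : Function.Surjective (evalHom a) := by
  rintro ⟨_, m, rfl⟩
  exact ⟨m, rfl⟩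

/-- The inclusion of `B_a` in `ℝ`. -/
def toReal (a : Label) : B a →+ ℝ := (latticeSubgroup a).subtype

theorem toReal_injective (a : Label) : Function.Injective (toReal a) := Subtype.val_injective

theorem toReal_evalHom (a : Label) (m : ℤ →₀ ℤ) :
    toReal a (evalHom a m) = m.sum fun n k => (k : ℝ) * (a : ℝ) ^ n := rfl

theorem evalHom_eq_zero_iff (a : Label) (m : ℤ →₀ ℤ) :
    evalHom a m = 0 ↔ (m.sum fun n k => (k : ℝ) * (a : ℝ) ^ n) = 0 :=
  Subtype.ext_iff

/-- The element `a ^ k` of `B_a`. -/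
def gen (a : Label) (k : ℤ) : Multiplicative (B a) :=
  Multiplicative.ofAdd (evalHom a (Finsupp.single k 1))

theorem mulAut_gen (a : Label) (k : ℤ) :
    AddEquiv.toMultiplicative (mulAut a) (gen a k) = gen a (k + 1) := by
  refine congrArg Multiplicative.ofAdd (Subtype.ext ?_)
  change (a : ℝ) * (Finsupp.single k (1 : ℤ)).sum (fun n k => (k : ℝ) * (a : ℝ) ^ n)
    = (Finsupp.single (k + 1) (1 : ℤ)).sum (fun n k => (k : ℝ) * (a : ℝ) ^ n)
  rw [Finsupp.sum_single_index (by simp), Finsupp.sum_single_index (by simp),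
    zpow_add_one₀ a.2.ne']
  simp [mul_comm]

theorem ofAdd_evalHom (a : Label) (m : ℤ →₀ ℤ) :
    Multiplicative.ofAdd (evalHom a m) = m.prod fun k c => gen a k ^ c := by
  induction m using Finsupp.induction_linear with
  | zero => simp
  | add m m' h h' =>
    rw [map_add, ofAdd_add, h, h', Finsupp.prod_add_index'] <;> simp [zpow_add]
  | single k c =>
    rw [Finsupp.prod_single_index (by simp), gen, ← ofAdd_zsmul, ← map_zsmul]
    simp

theorem monoidHom_ext_gen {a : Label} {M : Type*} [CommGroup M] {χ χ' : Multiplicative (B a) →* M}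
    (h : ∀ k, χ (gen a k) = χ' (gen a k)) : χ = χ' := by
  refine MonoidHom.ext fun b => ?_
  obtain ⟨m, hm⟩ := evalHom_surjective a (Multiplicative.toAdd b)
  rw [← ofAdd_toAdd b, ← hm, ofAdd_evalHom, Finsupp.prod, map_prod, map_prod]
  simp [h]

theorem dual_ext_gen {a : Label} {χ χ' : dualGroup a} (h : ∀ k, χ (gen a k) = χ' (gen a k)) :
    χ = χ' :=
  PontryaginDual.ext fun b =>
    DFunLike.congr_fun (monoidHom_ext_gen (χ := (χ : Multiplicative (B a) →* Circle))
      (χ' := (χ' : Multiplicative (B a) →* Circle)) h) b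

theorem exists_dual_of_forall_prod_eq_one {a : Label} (x : ℤ → Circle)
    (h : ∀ m : ℤ →₀ ℤ, evalHom a m = 0 → (m.prod fun k c => x k ^ c) = 1) :
    ∃ χ : dualGroup a, ∀ k, χ (gen a k) = x k := by
  let F : (ℤ →₀ ℤ) →+ Additive Circle :=
    { toFun := fun m => Additive.ofMul (m.prod fun k c => x k ^ c)
      map_zero' := by simp
      map_add' := fun m m' => by
        rw [Finsupp.prod_add_index'] <;> simp [zpow_add] }
  let L : B a →+ Additive Circle := AddMonoidHom.liftOfSurjective (evalHom a) (evalHom_surjective a)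
    ⟨F, fun m hm => congrArg Additive.ofMul (h m hm)⟩
  have hL : ∀ m, L (evalHom a m) = F m := fun m =>
    AddMonoidHom.liftOfRightInverse_comp_apply _ _ _ _ m
  refine ⟨(⟨AddMonoidHom.toMultiplicativeLeft L, continuous_of_discreteTopology⟩ :
    Multiplicative (B a) →ₜ* Circle), fun k => ?_⟩
  change Additive.toMul (L (evalHom a (Finsupp.single k 1))) = x k
  rw [hL]
  change (Finsupp.single k 1).prod (fun k c => x k ^ c) = x k
  simp

/-- Multiplication by `X ^ N` clears the negative exponents. As `g` does not depend on `w`, a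
relation tested on the powers of `a` transfers to every other sequence; allowing all large `N` lets
sums use a common shift. -/
theorem exists_polynomial_of_finsupp (m : ℤ →₀ ℤ) : ∃ N₀ : ℤ, ∀ N ≥ N₀, ∃ g : ℤ[X], ∀ w : ℤ → ℝ,
    (m.sum fun k c => (c : ℝ) * w k) = aeval (shift ℝ ℤ) g w (-N) := by
  induction m using Finsupp.induction_linear with
  | zero => exact ⟨0, fun N _ => ⟨0, fun w => by simp⟩⟩
  | add m m' h h' =>
    obtain ⟨N₀, h⟩ := h
    obtain ⟨N₁, h'⟩ := h'
    refine ⟨max N₀ N₁, fun N hN => ?_⟩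
    obtain ⟨g, hg⟩ := h N ((le_max_left _ _).trans hN)
    obtain ⟨g', hg'⟩ := h' N ((le_max_right _ _).trans hN)
    refine ⟨g + g', fun w => ?_⟩
    rw [Finsupp.sum_add_index' (by simp) (by intros; push_cast; ring), hg, hg', map_add]
    rfl
  | single k c =>
    refine ⟨-k, fun N hN => ⟨C c * X ^ (k + N).toNat, fun w => ?_⟩⟩
    rw [Finsupp.sum_single_index (by simp), map_mul, aeval_C, map_pow, aeval_X,
      Module.End.mul_apply]
    have h1 : (shift ℝ ℤ ^ (k + N).toNat) w (-N) = w k := by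
      rw [shift_pow_apply, Int.toNat_of_nonneg (by omega)]
      congr 1
      ring
    rw [show (c : ℝ) * w k = c • w k by simp, ← h1]
    simp

theorem aeval_shift_zpow {x : ℝ} (hx : x ≠ 0) (g : ℤ[X]) (k : ℤ) :
    aeval (shift ℝ ℤ) g (fun k => x ^ k) k = x ^ k * aeval x g := by
  rw [aeval_shift_apply, aeval_eq_sum_range, Finset.mul_sum]
  refine Finset.sum_congr rfl fun i _ => ?_
  rw [zpow_add₀ hx, zpow_natCast, zsmul_eq_mul]
  ring

theorem circle_exp_sum {ι : Type*} (s : Finset ι) (x : ι → ℝ) :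
    Circle.exp (∑ i ∈ s, x i) = ∏ i ∈ s, Circle.exp (x i) := by
  classical
  induction s using Finset.induction with
  | empty => simp
  | insert i s hi ih => rw [Finset.sum_insert hi, Finset.prod_insert hi, Circle.exp_add, ih]

theorem prod_exp_two_pi (m : ℤ →₀ ℤ) (w : ℤ → ℝ) :
    (m.prod fun k c => Circle.exp (2 * Real.pi * w k) ^ c)
      = Circle.exp (2 * Real.pi * m.sum fun k c => (c : ℝ) * w k) := by
  rw [Finsupp.mul_sum, Finsupp.sum, Finsupp.prod, circle_exp_sum]
  refine Finset.prod_congr rfl fun k _ => ?_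
  rw [← Circle.exp_intCast_mul]
  congr 1
  ring

theorem circle_exp_two_pi_mul_eq_one_iff {x : ℝ} :
    Circle.exp (2 * Real.pi * x) = 1 ↔ ∃ j : ℤ, x = j := by
  rw [Circle.exp_eq_one]
  refine exists_congr fun j => ?_
  rw [mul_comm, mul_left_inj' (by positivity)]

/-- A real sequence whose image under `f(shift)` is integral gives a character of `B_a`. -/
theorem exists_dual_of_lift {a : Label} {f : ℤ[X]} (hf : ∀ g : ℤ[X], aeval (a : ℝ) g = 0 → f ∣ g)
    (w : ℤ → ℝ) (hw : ∀ k, ∃ j : ℤ, aeval (shift ℝ ℤ) f w k = j) :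
    ∃ χ : dualGroup a, ∀ k, χ (gen a k) = Circle.exp (2 * Real.pi * w k) := by
  refine exists_dual_of_forall_prod_eq_one _ fun m hm => ?_
  rw [prod_exp_two_pi, circle_exp_two_pi_mul_eq_one_iff]
  obtain ⟨N, h⟩ := exists_polynomial_of_finsupp m
  obtain ⟨g, hg⟩ := h N le_rfl
  -- On the sequence of powers of `a`, the relation says that `g` vanishes at `a`, hence that `f`
  -- divides `g`.
  rw [evalHom_eq_zero_iff, hg, aeval_shift_zpow a.2.ne'] at hm
  obtain ⟨h, rfl⟩ := hf g ((mul_eq_zero.1 hm).resolve_left (zpow_ne_zero _ a.2.ne'))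
  rw [hg]
  exact exists_int_aeval_shift_mul hw h _

/-- The relation `a ^ k * f(a) = 0` holds in `B_a`, and `χ` sends it to `1`. -/
theorem exists_int_of_lift {a : Label} {f : ℤ[X]} (hf : aeval (a : ℝ) f = 0) (χ : dualGroup a)
    (w : ℤ → ℝ) (hw : ∀ k, χ (gen a k) = Circle.exp (2 * Real.pi * w k)) (k : ℤ) :
    ∃ j : ℤ, aeval (shift ℝ ℤ) f w k = j := by
  have h0 : evalHom a (∑ i ∈ Finset.range (f.natDegree + 1),
      Finsupp.single (k + i) (f.coeff i)) = 0 := by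
    apply toReal_injective a
    have h1 := aeval_shift_zpow a.2.ne' f k
    rw [hf, mul_zero, aeval_shift_apply] at h1
    rw [map_sum, map_sum, map_zero, ← h1]
    refine Finset.sum_congr rfl fun i _ => ?_
    rw [toReal_evalHom, Finsupp.sum_single_index (by simp)]
  rw [← circle_exp_two_pi_mul_eq_one_iff, aeval_shift_apply, Finset.mul_sum, circle_exp_sum]
  have h1 : ∀ i ∈ Finset.range (f.natDegree + 1),
      Circle.exp (2 * Real.pi * (f.coeff i * w (k + i)))
        = χ (Multiplicative.ofAdd (evalHom a (Finsupp.single (k + i) (f.coeff i)))) := by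
    intro i _
    rw [ofAdd_evalHom, Finsupp.prod_single_index (by simp), map_zpow, hw,
      ← Circle.exp_intCast_mul]
    congr 1
    ring
  rw [Finset.prod_congr rfl h1, ← map_prod, ← ofAdd_sum, ← map_sum, h0, ofAdd_zero, map_one]

/-! ### The dual automorphism in coordinates -/

theorem dualAut_apply {a : Label} (χ : dualGroup a) (b : Multiplicative (B a)) :
    dualAut a χ b = χ (AddEquiv.toMultiplicative (mulAut a) b) := rfl

theorem dualAut_iterate_gen {a : Label} (χ : dualGroup a) (j : ℕ) (k : ℤ) :
    ((dualAut a)^[j] χ) (gen a k) = χ (gen a (k + j)) := by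
  induction j generalizing k with
  | zero => simp
  | succ j ih =>
    rw [Function.iterate_succ_apply', dualAut_apply, mulAut_gen, ih]
    congr 2
    push_cast
    ring

theorem dualAut_symm_iterate_gen {a : Label} (χ : dualGroup a) (j : ℕ) (k : ℤ) :
    ((dualAut a).symm^[j] χ) (gen a k) = χ (gen a (k - j)) := by
  have h := dualAut_iterate_gen ((dualAut a).symm^[j] χ) j (k - j)
  rw [sub_add_cancel] at h
  rw [← h]
  congr 1
  exact (Function.LeftInverse.iterate (dualAut a).apply_symm_apply j) χ

theorem mem_PerDvd_iff {a : Label} {q : ℕ} {χ : dualGroup a} :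
    χ ∈ PerDvd q a ↔ ∀ k, χ (gen a (k + q)) = χ (gen a k) := by
  simp only [← dualAut_iterate_gen]
  exact ⟨fun h k => by rw [show (dualAut a)^[q] χ = χ from h], fun h => dual_ext_gen h⟩

theorem PerDvd_apply_gen {a : Label} {q : ℕ} {χ : dualGroup a} (h : χ ∈ PerDvd q a) (k j : ℤ) :
    χ (gen a (k + q * j)) = χ (gen a k) := by
  induction j using Int.induction_on with
  | zero => simp
  | succ j ih => rw [← ih, mul_add_one, ← add_assoc, mem_PerDvd_iff.1 h]
  | pred j ih => rw [← ih, ← mem_PerDvd_iff.1 h]; congr 2; ring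

theorem PerDvd_apply_gen_emod {a : Label} {q : ℕ} {χ : dualGroup a} (h : χ ∈ PerDvd q a) (k : ℤ) :
    χ (gen a (k % q)) = χ (gen a k) := by
  rw [← PerDvd_apply_gen h (k % q) (k / q), Int.emod_add_mul_ediv]

theorem one_mem_PerDvd (q : ℕ) (a : Label) : 1 ∈ PerDvd q a :=
  mem_PerDvd_iff.2 fun _ => rfl

theorem continuous_apply_gen {a : Label} (b : Multiplicative (B a)) :
    Continuous fun χ : dualGroup a => χ b :=
  (ContinuousEvalConst.continuous_eval_const (F := C(Multiplicative (B a), Circle)) b).comp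
    (ContinuousMonoidHom.isInducing_toContinuousMap (Multiplicative (B a)) Circle).continuous

/-- The uniform structure on the dual group that enters the entropy. -/
instance (a : Label) : UniformSpace (dualGroup a) :=
  IsTopologicalGroup.rightUniformSpace (dualGroup a)

theorem entropy_eq (a : Label) : entropy a = Dynamics.coverEntropy (dualAut a) Set.univ := rfl

theorem mem_uniformity_dual_iff {a : Label} {U : Set (dualGroup a × dualGroup a)} :
    U ∈ uniformity (dualGroup a) ↔ ∃ W ∈ nhds (1 : dualGroup a), ∀ p : dualGroup a × dualGroup a,
      p.2 / p.1 ∈ W → p ∈ U := by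
  have h : uniformity (dualGroup a)
      = Filter.comap (fun p : dualGroup a × dualGroup a => p.2 / p.1) (nhds 1) := by
    simp only [div_eq_mul_inv]; rfl
  rw [h, Filter.mem_comap]
  rfl

/-- The coordinates of a character in the generators `a ^ k`. -/
def coords (a : Label) (χ : dualGroup a) : ℤ → Circle := fun k => χ (gen a k)

theorem isClosedEmbedding_coords (a : Label) : Topology.IsClosedEmbedding (coords a) :=
  (continuous_pi fun _ => continuous_apply_gen _).isClosedEmbedding
    fun _ _ h => dual_ext_gen (congrFun h)

/-- The dual is compact and coordinates separate its points, so its topology is that of the product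
of circles: an entourage is controlled by finitely many coordinates. -/
theorem exists_window {a : Label} {U : Set (dualGroup a × dualGroup a)}
    (hU : U ∈ uniformity (dualGroup a)) :
    ∃ m : ℕ, ∃ V ∈ nhds (1 : Circle), ∀ p : dualGroup a × dualGroup a,
      (∀ k : ℤ, -m ≤ k → k ≤ m → (p.2 / p.1) (gen a k) ∈ V) → p ∈ U := by
  obtain ⟨W, hW, h⟩ := mem_uniformity_dual_iff.1 hU
  rw [(isClosedEmbedding_coords a).isInducing.nhds_eq_comap, Filter.mem_comap] at hW
  obtain ⟨W', hW', hWW'⟩ := hW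
  rw [nhds_pi, Filter.mem_pi] at hW'
  obtain ⟨I, hI, t, ht, hIt⟩ := hW'
  obtain ⟨m, hm⟩ := (hI.toFinset.image Int.natAbs).exists_le
  refine ⟨m, ⋂ i ∈ I, t i, (Filter.biInter_mem hI).2 fun i _ => ht i, fun p hp => h p (hWW' (hIt ?_))⟩
  intro i hi
  have him : i.natAbs ≤ m := hm _ (Finset.mem_image_of_mem _ (hI.mem_toFinset.2 hi))
  exact Set.mem_iInter₂.1 (hp i (by omega) (by omega)) i hi

/-! ### Periodic points are separated -/

theorem aeval_shift_comp_cast {n : ℕ} (f : ℤ[X]) (v : ZMod n → ℝ) (k : ℤ) :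
    aeval (shift ℝ ℤ) f (fun k => v (k : ℤ)) k = aeval (shift ℝ (ZMod n)) f v (k : ZMod n) := by
  simp [aeval_shift_apply]

/-- The logarithm of a point of the circle, in `(-1/2, 1/2]`. -/
def lift (z : Circle) : ℝ := Complex.arg z / (2 * Real.pi)

theorem exp_lift (z : Circle) : Circle.exp (2 * Real.pi * lift z) = z := by
  rw [lift, mul_div_cancel₀ _ (by positivity), Circle.exp_arg]

theorem lift_mem_nhds {δ : ℝ} (hδ : 0 < δ) : {z : Circle | |lift z| < δ} ∈ nhds (1 : Circle) := by
  have h : ContinuousAt lift 1 := by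
    refine ContinuousAt.div_const (ContinuousAt.comp (g := Complex.arg) ?_ ?_) _
    · exact Complex.continuousAt_arg (by simp)
    · exact continuous_subtype_val.continuousAt
  have h0 : lift 1 = 0 := by simp [lift]
  have := h.eventually_mem (s := {x | |x| < δ}) (by
    rw [h0]
    exact (continuous_abs.isOpen_preimage _ isOpen_Iio).mem_nhds (by simpa using hδ))
  exact this

/-- The polynomials `f` for which the dual of `B_a` is the solution space of `f(shift) = 0`. -/
structure IsDefining (a : Label) (f : ℤ[X]) : Prop where
  ne_zero : f ≠ 0
  aeval_eq : aeval (a : ℝ) f = 0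
  dvd : ∀ g : ℤ[X], aeval (a : ℝ) g = 0 → f ∣ g
  pow_ne_one : ∀ z ∈ (f.map (Int.castRingHom ℂ)).roots, ∀ n : ℕ, 0 < n → z ^ n ≠ 1

theorem exists_isDefining {a : Label} (ha : (a : ℝ) ≠ 1) (h : IsAlgebraic ℤ (a : ℝ)) :
    ∃ f, IsDefining a f := by
  obtain ⟨f, hirr, hprim, hf, hdvd⟩ := exists_irreducible_forall_dvd h
  exact ⟨f, hirr.ne_zero, hf, hdvd, fun z hz n hn => pow_ne_one_of_mem_roots a.2 ha hirr hprim hf hz hn⟩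

theorem IsDefining.aeval_shift_injective {a : Label} {f : ℤ[X]} (hf : IsDefining a f) (n : ℕ)
    [NeZero n] : Function.Injective (aeval (shift ℝ (ZMod n)) f) := by
  -- Here `n` is fixed, so `K` may depend on it; `0` is inserted to make `K` nonnegative.
  obtain ⟨K, hK⟩ := (insert 0 ((f.map (Int.castRingHom ℂ)).roots.toFinset.image fun z =>
    (∑ j ∈ Finset.range n, ‖z‖ ^ j) / ‖1 - z ^ n‖)).exists_le
  rw [injective_iff_map_eq_zero]
  intro x hx
  have h := norm_le_norm_aeval_shift_real (hK 0 (Finset.mem_insert_self _ _)) hf.ne_zero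
    (fun z hz => ?_) x
  · rwa [hx, norm_zero, mul_zero, norm_le_zero_iff] at h
  · have h1 := hf.pow_ne_one z hz n (NeZero.pos n)
    refine ⟨h1, ?_⟩
    rw [← div_le_iff₀ (norm_pos_iff.2 (sub_ne_zero.2 (Ne.symm h1)))]
    exact hK _ (Finset.mem_insert_of_mem (Finset.mem_image_of_mem _ (Multiset.mem_toFinset.2 hz)))

/-- If the lifts are small against the coefficients of `f`, then `f(shift)` of the lift is integral
and of absolute value less than one, hence zero, and injectivity on periodic sequences kills the
lift. The threshold does not depend on `n`. -/
theorem IsDefining.exists_eq_one_of_abs_lift_lt {a : Label} {f : ℤ[X]} (hf : IsDefining a f) :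
    ∃ δ > 0, ∀ n : ℕ, 0 < n → ∀ χ ∈ PerDvd n a,
      (∀ k : ℕ, k < n → |lift (χ (gen a k))| < δ) → χ = 1 := by
  set S : ℝ := ∑ i ∈ Finset.range (f.natDegree + 1), |(f.coeff i : ℝ)| with hS
  have hS0 : 0 ≤ S := Finset.sum_nonneg fun _ _ => abs_nonneg _
  refine ⟨1 / (S + 1), by positivity, fun n hn χ hχ h => ?_⟩
  have : NeZero n := ⟨hn.ne'⟩
  set v : ZMod n → ℝ := fun k => lift (χ (gen a k.val)) with hv
  have hχv : ∀ k : ℤ, χ (gen a k) = Circle.exp (2 * Real.pi * v (k : ZMod n)) := fun k => by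
    rw [hv, exp_lift, ZMod.val_intCast, PerDvd_apply_gen_emod hχ]
  have h0 : aeval (shift ℝ (ZMod n)) f v = 0 := by
    funext k
    obtain ⟨k, rfl⟩ := ZMod.intCast_surjective k
    obtain ⟨j, hj⟩ := exists_int_of_lift hf.aeval_eq χ (fun k => v (k : ℤ)) hχv k
    rw [aeval_shift_comp_cast] at hj
    have hlt : |(j : ℝ)| < 1 := by
      rw [← hj, aeval_shift_apply]
      calc _ ≤ ∑ i ∈ Finset.range (f.natDegree + 1), |(f.coeff i : ℝ) * v (k + i)| :=
            Finset.abs_sum_le_sum_abs _ _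
        _ ≤ ∑ i ∈ Finset.range (f.natDegree + 1), |(f.coeff i : ℝ)| * (1 / (S + 1)) :=
            Finset.sum_le_sum fun i _ => by
              rw [abs_mul]
              exact mul_le_mul_of_nonneg_left (h _ (ZMod.val_lt _)).le (abs_nonneg _)
        _ = S / (S + 1) := by rw [← Finset.sum_mul, ← hS]; ring
        _ < 1 := by rw [div_lt_one (by positivity)]; linarith
    have hj0 : j = 0 := by
      have : |j| < 1 := by exact_mod_cast hlt
      exact Int.abs_lt_one_iff.1 this
    rw [hj, hj0]
    simp
  have hv0 : v = 0 := hf.aeval_shift_injective n (by rw [h0, map_zero])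
  exact dual_ext_gen fun k => by rw [hχv, hv0]; simp

/-- The entourage looks at coordinate `0` only, and the dynamics moves it over `0, …, n - 1`. If the
dynamical balls of two periodic points meet, the quotient of the points is close to `1` on a full
period, so they coincide. -/
theorem IsDefining.exists_encard_PerDvd_le {a : Label} {f : ℤ[X]} (hf : IsDefining a f) :
    ∃ U ∈ uniformity (dualGroup a), ∀ n : ℕ, 0 < n →
      (PerDvd n a).encard ≤ Dynamics.netMaxcard (dualAut a) Set.univ U n := by
  obtain ⟨δ, hδ, h⟩ := hf.exists_eq_one_of_abs_lift_lt
  obtain ⟨V, hV, hVV⟩ := exists_nhds_one_split (lift_mem_nhds hδ)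
  -- Symmetry is needed because `x / y` is the product of `(z / x)⁻¹` and `z / y`.
  set W : Set Circle := V ∩ V⁻¹
  have hW : W ∈ nhds (1 : Circle) := Filter.inter_mem hV (inv_mem_nhds_one _ hV)
  refine ⟨{p | (p.2 / p.1) (gen a 0) ∈ W}, mem_uniformity_dual_iff.2
    ⟨{χ | χ (gen a 0) ∈ W}, (continuous_apply_gen (gen a 0)).continuousAt.preimage_mem_nhds hW,
      fun p hp => hp⟩, fun n hn => ?_⟩
  -- Finiteness of the periodic set is not yet known, so the bound is checked on its finite subsets.
  refine ENat.forall_natCast_le_iff_le.1 fun c hc => ?_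
  obtain ⟨t, ht, htc⟩ := Set.exists_subset_encard_eq hc
  have htfin : t.Finite := Set.finite_of_encard_eq_coe htc
  have hnet : Dynamics.IsDynNetIn (dualAut a) Set.univ {p | (p.2 / p.1) (gen a 0) ∈ W} n
      (htfin.toFinset : Set (dualGroup a)) := by
    refine ⟨Set.subset_univ _, fun x hx y hy hxy => Set.disjoint_left.2 fun z hzx hzy => hxy ?_⟩
    rw [htfin.coe_toFinset] at hx hy
    have hmem := mem_PerDvd_iff.1 (ht hx)
    have hmem' := mem_PerDvd_iff.1 (ht hy)
    refine div_eq_one.1 (h n hn (x / y) (mem_PerDvd_iff.2 fun k => ?_) fun k hk => ?_)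
    · change x _ / y _ = x _ / y _
      rw [hmem, hmem']
    · have h1 := (Dynamics.mem_dynEntourage.1 hzx) k hk
      have h2 := (Dynamics.mem_dynEntourage.1 hzy) k hk
      change ((dualAut a)^[k] z) (gen a 0) / ((dualAut a)^[k] x) (gen a 0) ∈ W at h1
      change ((dualAut a)^[k] z) (gen a 0) / ((dualAut a)^[k] y) (gen a 0) ∈ W at h2
      rw [dualAut_iterate_gen, dualAut_iterate_gen, zero_add] at h1 h2
      have h3 := hVV _ h1.2 _ h2.1
      rw [inv_div, div_mul_div_cancel] at h3
      exact h3
  have := hnet.card_le_netMaxcard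
  rwa [← Set.encard_coe_eq_coe_finsetCard, htfin.coe_toFinset, htc] at this

theorem IsDefining.finite_PerDvd {a : Label} {f : ℤ[X]} (hf : IsDefining a f) {n : ℕ} (hn : 0 < n) :
    (PerDvd n a).Finite := by
  obtain ⟨U, hU, h⟩ := hf.exists_encard_PerDvd_le
  rw [← Set.encard_lt_top_iff]
  refine (h n hn).trans_lt ?_
  exact (Dynamics.netMaxcard_le_coverMincard (dualAut a) Set.univ n).trans_lt
    (Dynamics.coverMincard_finite_of_isCompact_uniformContinuous isCompact_univ
      (CompactSpace.uniformContinuous_of_continuous (dualAut a).continuous) hU n)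

open Polynomial Filter

/-! ### Shadowing by periodic points -/

/-- Away from the last `f.natDegree` indices the window does not wrap around modulo `n`, so the
value agrees with the integral one computed over `ℤ`. -/
theorem IsDefining.aeval_shift_lift_eq {a : Label} {f : ℤ[X]} (hf : IsDefining a f) {n : ℕ}
    [NeZero n] (χ : dualGroup a) (k : ZMod n) (hk : k.val + f.natDegree < n) :
    ∃ j : ℤ, aeval (shift ℝ (ZMod n)) f (fun k => lift (χ (gen a k.val))) k = j := by
  obtain ⟨j, hj⟩ := exists_int_of_lift hf.aeval_eq χ (fun k => lift (χ (gen a k)))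
    (fun k => (exp_lift _).symm) k.val
  refine ⟨j, ?_⟩
  rw [← hj, aeval_shift_apply, aeval_shift_apply]
  refine Finset.sum_congr rfl fun i hi => ?_
  rw [Finset.mem_range] at hi
  have h : (k + (i : ZMod n)).val = k.val + i := by
    rw [ZMod.val_add, ZMod.val_natCast, Nat.mod_eq_of_lt (a := i) (by omega),
      Nat.mod_eq_of_lt (by omega)]
  simp only [h, Nat.cast_add]

/-- The periodic point attached to a character, together with the correction in the coordinates. -/
theorem IsDefining.exists_periodic {a : Label} {f : ℤ[X]} (hf : IsDefining a f) (n : ℕ) [NeZero n]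
    (χ : dualGroup a) : ∃ ψ ∈ PerDvd n a, ∃ u : ZMod n → ℝ,
      (∀ k : ZMod n, χ (gen a k.val) = ψ (gen a k.val) * Circle.exp (2 * Real.pi * u k)) ∧
      (∀ k, 0 ≤ aeval (shift ℝ (ZMod n)) f u k ∧ aeval (shift ℝ (ZMod n)) f u k < 1) ∧
      ∀ k : ZMod n, k.val + f.natDegree < n → aeval (shift ℝ (ZMod n)) f u k = 0 := by
  set w : ZMod n → ℝ := fun k => lift (χ (gen a k.val)) with hw
  set F := aeval (shift ℝ (ZMod n)) f with hF
  -- Subtracting a preimage `u` of the fractional part of `F w` makes `F (w - u)` integral, so that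
  -- `w - u` lifts a periodic character.
  obtain ⟨u, hu⟩ := LinearMap.injective_iff_surjective.1 (hf.aeval_shift_injective n)
    fun k => Int.fract (F w k)
  obtain ⟨ψ, hψ⟩ := exists_dual_of_lift hf.dvd (fun k : ℤ => (w - u) (k : ZMod n)) fun k => by
    refine ⟨⌊F w k⌋, ?_⟩
    rw [aeval_shift_comp_cast, map_sub, hu, Pi.sub_apply]
    exact Int.self_sub_fract _
  refine ⟨ψ, mem_PerDvd_iff.2 fun k => ?_, u, fun k => ?_, fun k => ?_, fun k hk => ?_⟩
  · rw [hψ, hψ]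
    simp
  · rw [hψ, ← Circle.exp_add]
    have hk : (((k.val : ℕ) : ℤ) : ZMod n) = k := by rw [Int.cast_natCast, ZMod.natCast_zmod_val]
    simp only [hk, Pi.sub_apply]
    rw [← mul_add, sub_add_cancel, hw, exp_lift]
  · rw [hF, hu]
    exact ⟨Int.fract_nonneg _, Int.fract_lt_one _⟩
  · obtain ⟨j, hj⟩ := hf.aeval_shift_lift_eq χ k hk
    rw [hF, hu, hw]
    simp only [hF, hj, Int.fract_intCast]

/-- The code records the periodic point and, rounded to `M` bins, the values of `F u` on the last
coordinates, the only ones where it can be nonzero. Equal codes give `‖F (u' - u)‖ ≤ 1 / M`, and the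
a priori bound turns this into closeness of the characters. -/
theorem IsDefining.exists_coding {a : Label} {f : ℤ[X]} (hf : IsDefining a f) {n : ℕ} [NeZero n]
    {K ε : ℝ} (hK : 0 ≤ K) (hroots : ∀ z ∈ (f.map (Int.castRingHom ℂ)).roots,
      ∑ j ∈ Finset.range n, ‖z‖ ^ j ≤ K * ‖1 - z ^ n‖)
    {M : ℕ} (hM : 0 < M) (hε : K ^ f.natDegree ≤ ε * M) :
    ∃ Φ : dualGroup a → PerDvd n a × (Fin f.natDegree → Fin M), ∀ χ χ', Φ χ = Φ χ' →
      ∀ k : ℕ, k < n → ∃ x : ℝ, |x| ≤ ε ∧ (χ' / χ) (gen a k) = Circle.exp (2 * Real.pi * x) := by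
  choose ψ hψ u hu he he0 using hf.exists_periodic n
  set F := aeval (shift ℝ (ZMod n)) f with hF
  have hMpos : (0 : ℝ) < M := by exact_mod_cast hM
  -- The indices `n - 1 - i` cover the last coordinates; when the degree exceeds `n`, truncated
  -- subtraction only repeats index `0`.
  refine ⟨fun χ => (⟨ψ χ, hψ χ⟩, fun i => ⟨⌊F (u χ) ((n - 1 - i : ℕ) : ZMod n) * M⌋₊, ?_⟩), ?_⟩
  · rw [Nat.floor_lt (mul_nonneg (he _ _).1 hMpos.le)]
    exact mul_lt_of_lt_one_left hMpos (he _ _).2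
  intro χ χ' h k hk
  rw [Prod.mk.injEq, Subtype.mk.injEq] at h
  have hclose : ‖F (u χ' - u χ)‖ ≤ 1 / M := by
    refine (pi_norm_le_iff_of_nonneg (by positivity)).2 fun k => ?_
    rw [map_sub, Pi.sub_apply, Real.norm_eq_abs]
    by_cases hkd : k.val + f.natDegree < n
    · rw [he0 _ _ hkd, he0 _ _ hkd, sub_zero, abs_zero]
      positivity
    · have hkn := ZMod.val_lt k
      have h1 := Fin.ext_iff.1 (congrFun h.2 ⟨n - 1 - k.val, by omega⟩)
      have h2 : n - 1 - (n - 1 - k.val) = k.val := by omega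
      simp only [h2, ZMod.natCast_val, ZMod.cast_id] at h1
      have a1 := Nat.floor_le (mul_nonneg (he χ k).1 hMpos.le)
      have a2 := Nat.lt_floor_add_one (F (u χ) k * M)
      have b1 := Nat.floor_le (mul_nonneg (he χ' k).1 hMpos.le)
      have b2 := Nat.lt_floor_add_one (F (u χ') k * M)
      rw [h1] at a1 a2
      rw [le_div_iff₀ hMpos]
      rw [show ∀ x : ℝ, |x| * M = |x * M| from fun x => by rw [abs_mul, abs_of_pos hMpos],
        sub_mul, abs_le]
      constructor <;> linarith
  have hnorm := norm_le_norm_aeval_shift_real hK hf.ne_zero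
    (fun z hz => ⟨hf.pow_ne_one z hz n (NeZero.pos n), hroots z hz⟩) (u χ' - u χ)
  refine ⟨(u χ' - u χ) (k : ZMod n), ?_, ?_⟩
  · rw [← Real.norm_eq_abs]
    refine (norm_le_pi_norm _ _).trans (hnorm.trans ?_)
    calc _ ≤ K ^ f.natDegree * (1 / M) := by gcongr
      _ ≤ ε * M * (1 / M) := by gcongr
      _ = ε := by field_simp
  · have h1 := hu χ (k : ZMod n)
    have h2 := hu χ' (k : ZMod n)
    rw [ZMod.val_natCast, Nat.mod_eq_of_lt hk] at h1 h2
    change χ' _ / χ _ = _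
    rw [h1, h2, h.1, mul_div_mul_left_eq_div, ← Circle.exp_sub, ← mul_sub]
    rfl

theorem coverMincard_le_of_coding {X κ : Type*} [Finite κ] (T : X → X) (U : SetRel X X) (n : ℕ)
    (Φ : X → κ) (h : ∀ x y, Φ x = Φ y → (x, y) ∈ Dynamics.dynEntourage T U n) :
    Dynamics.coverMincard T Set.univ U n ≤ Nat.card κ := by
  classical
  have hfin : (Set.range Φ).Finite := Set.toFinite _
  cases isEmpty_or_nonempty X
  · simp [Set.univ_eq_empty_iff.2 ‹_›]
  choose! g hg using fun c (hc : c ∈ Set.range Φ) => hc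
  have hcov : Dynamics.IsDynCoverOf T Set.univ U n (hfin.toFinset.image g : Finset X) := by
    intro x _
    refine ⟨g (Φ x), ?_, h _ _ (hg _ ⟨x, rfl⟩).symm⟩
    rw [Finset.coe_image, hfin.coe_toFinset]
    exact ⟨_, ⟨x, rfl⟩, rfl⟩
  refine hcov.coverMincard_le_card.trans ?_
  refine Nat.cast_le.2 (Finset.card_image_le.trans ?_)
  rw [← Set.ncard_eq_toFinset_card _ hfin]
  exact Set.ncard_le_card _

/-- Following the window `[-m, m]` for `n - 2 * m` steps uses coordinates from `-m` to `n - m - 1`,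
which the `m`-th backward iterate places on `0, …, n - 1`, where the coding applies. The linear
growth `K * n` of the inverse bound makes `M` polynomial in `n`. -/
theorem IsDefining.exists_coverMincard_le {a : Label} {f : ℤ[X]} (hf : IsDefining a f)
    {U : Set (dualGroup a × dualGroup a)} (hU : U ∈ uniformity (dualGroup a)) :
    ∃ m : ℕ, ∃ C : ℝ, 1 ≤ C ∧ ∃ᶠ n : ℕ in atTop, ∃ M : ℕ, 0 < M ∧ (M : ℝ) ≤ C * n ^ f.natDegree ∧
      Dynamics.coverMincard (dualAut a) Set.univ U (n - 2 * m)
        ≤ (PerDvd n a).ncard * M ^ f.natDegree := by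
  obtain ⟨m, V, hV, hVU⟩ := exists_window hU
  obtain ⟨ε, hε, hεV⟩ : ∃ ε > 0, ∀ x : ℝ, |x| ≤ ε → Circle.exp (2 * Real.pi * x) ∈ V := by
    have hc : Continuous fun x : ℝ => Circle.exp (2 * Real.pi * x) := by fun_prop
    have := hc.continuousAt.preimage_mem_nhds (x := 0) (t := V) (by simpa using hV)
    obtain ⟨ε, hε, h⟩ := Metric.nhds_basis_closedBall.mem_iff.1 this
    exact ⟨ε, hε, fun x hx => h (by simpa using hx)⟩
  obtain ⟨K, hK, hgood⟩ := exists_frequently_sum_norm_pow_le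
    (f.map (Int.castRingHom ℂ)).roots.toFinset fun z hz => hf.pow_ne_one z (Multiset.mem_toFinset.1 hz)
  refine ⟨m, K ^ f.natDegree / ε + 1, le_add_of_nonneg_left (by positivity), ?_⟩
  rw [frequently_atTop]
  intro n₀
  obtain ⟨n, hn, h⟩ := hgood (n₀ + 1)
  have : NeZero n := ⟨by omega⟩
  have hn1 : (1 : ℝ) ≤ n := by exact_mod_cast (by omega : 1 ≤ n)
  have hx0 : 0 ≤ (K * n) ^ f.natDegree / ε := by positivity
  refine ⟨n, by omega, ⌊(K * n) ^ f.natDegree / ε⌋₊ + 1, Nat.succ_pos _, ?_, ?_⟩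
  · push_cast
    calc (⌊(K * n) ^ f.natDegree / ε⌋₊ : ℝ) + 1 ≤ (K * n) ^ f.natDegree / ε + 1 := by
          gcongr; exact Nat.floor_le hx0
      _ ≤ (K * n) ^ f.natDegree / ε + n ^ f.natDegree := by gcongr; exact one_le_pow₀ hn1
      _ = _ := by rw [mul_pow]; ring
  · obtain ⟨Φ, hΦ⟩ := hf.exists_coding (ε := ε) (K := K * n) (by positivity)
      (fun z hz => h z (Multiset.mem_toFinset.2 hz)) (Nat.succ_pos ⌊(K * n) ^ f.natDegree / ε⌋₊) (by
        rw [← div_le_iff₀' hε]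
        exact_mod_cast (Nat.lt_floor_add_one _).le)
    have : Finite (PerDvd n a) := hf.finite_PerDvd (NeZero.pos n)
    refine (coverMincard_le_of_coding (dualAut a) U (n - 2 * m)
      (fun χ => Φ ((dualAut a).symm^[m] χ)) fun χ χ' hχ => ?_).trans ?_
    · refine Dynamics.mem_dynEntourage.2 fun j hj => hVU _ fun k hk hk' => ?_
      obtain ⟨x, hx, hx'⟩ := hΦ _ _ hχ (k + j + m).toNat (by omega)
      change ((dualAut a)^[j] χ') _ / ((dualAut a)^[j] χ) _ ∈ V
      change ((dualAut a).symm^[m] χ') _ / ((dualAut a).symm^[m] χ) _ = _ at hx'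
      rw [dualAut_symm_iterate_gen, dualAut_symm_iterate_gen, Int.toNat_of_nonneg (by omega),
        add_sub_cancel_right] at hx'
      rw [dualAut_iterate_gen, dualAut_iterate_gen, hx']
      exact hεV x hx
    · rw [Nat.card_prod, Nat.card_coe_set_eq]
      simp

theorem tendsto_mul_add_log_div_sub (r A C : ℝ) (m : ℕ) :
    Tendsto (fun n : ℕ => (r * n + (A + C * Real.log n)) / ((n - 2 * m : ℕ) : ℝ)) atTop (nhds r) := by
  have hinv : Tendsto (fun n : ℕ => ((n : ℝ))⁻¹) atTop (nhds 0) :=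
    tendsto_inv_atTop_zero.comp tendsto_natCast_atTop_atTop
  have hlog : Tendsto (fun n : ℕ => Real.log n / n) atTop (nhds 0) :=
    (Real.isLittleO_log_id_atTop.tendsto_div_nhds_zero).comp tendsto_natCast_atTop_atTop
  have h := ((tendsto_const_nhds (x := r)).add ((hinv.const_mul A).add (hlog.const_mul C))).div
    ((tendsto_const_nhds (x := (1 : ℝ))).sub (hinv.const_mul (2 * m : ℝ))) (by simp)
  simp only [mul_zero, add_zero, sub_zero, div_one] at h
  refine h.congr' ?_
  filter_upwards [eventually_gt_atTop (2 * m)] with n hn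
  have hn0 : (n : ℝ) ≠ 0 := by exact_mod_cast (by omega : n ≠ 0)
  have hn1 : (n : ℝ) - 2 * m ≠ 0 := by
    rw [sub_ne_zero]
    exact_mod_cast hn.ne'
  rw [Nat.cast_sub hn.le]
  push_cast
  simp only [Pi.div_apply]
  field_simp

open ExpGrowth in
-- Good times that are merely frequent suffice: by submultiplicativity of covers, each single time
-- bounds the entropy at `U` through a cover for `V` with `V ○ V ⊆ U`. The polynomial factor `M ^ d`
-- disappears after taking logarithms and dividing by time.
theorem IsDefining.coverEntropyEntourage_le {a : Label} {f : ℤ[X]} (hf : IsDefining a f)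
    {U : Set (dualGroup a × dualGroup a)} (hU : U ∈ uniformity (dualGroup a)) :
    Dynamics.coverEntropyEntourage (dualAut a) Set.univ U
      ≤ expGrowthSup fun n => ((PerDvd n a).encard : ℝ≥0∞) := by
  obtain ⟨V, hV, hVs, hVU⟩ := comp_symm_mem_uniformity_sets hU
  obtain ⟨m, C, hC, hfreq⟩ := hf.exists_coverMincard_le hV
  set d := f.natDegree
  refine EReal.le_of_forall_lt_iff_le.1 fun r hr => ?_
  have hev := eventually_lt_of_limsup_lt hr
  refine ge_of_tendsto_of_frequently
    ((continuous_coe_real_ereal.tendsto r).comp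
      (tendsto_mul_add_log_div_sub r (d * Real.log C) (d * d) m)) ?_
  refine (hfreq.and_eventually (hev.and (eventually_gt_atTop (2 * m)))).mono ?_
  rintro n ⟨⟨M, hM, hMC, hcov⟩, hlt, hn⟩
  have hn1 : (1 : ℝ) ≤ n := by exact_mod_cast (by omega : 1 ≤ n)
  have hfin : (PerDvd n a).Finite := hf.finite_PerDvd (by omega)
  have hcard : 0 < (PerDvd n a).ncard :=
    (Set.ncard_pos hfin).2 ⟨1, one_mem_PerDvd n a⟩
  have hcardR : (0 : ℝ) < (PerDvd n a).ncard := by exact_mod_cast hcard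
  have hMR : (0 : ℝ) < M := by exact_mod_cast hM
  have hlog : Real.log (PerDvd n a).ncard < r * n := by
    beta_reduce at hlt
    rw [← hfin.cast_ncard_eq, ENat.toENNReal_coe, ← ENNReal.ofReal_natCast,
      ENNReal.log_ofReal_of_pos hcardR] at hlt
    have : ((Real.log (PerDvd n a).ncard / (n : ℝ) : ℝ) : EReal) < (r : EReal) := by
      rw [EReal.coe_div]
      exact hlt
    rwa [EReal.coe_lt_coe_iff, div_lt_iff₀ (by positivity)] at this
  calc Dynamics.coverEntropyEntourage (dualAut a) Set.univ U
      ≤ _ := Dynamics.coverEntropyEntourage_antitone _ _ hVU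
    _ ≤ _ := Dynamics.coverEntropyEntourage_le_log_coverMincard_div (Set.mapsTo_univ _ _)
      (Nat.sub_ne_zero_of_lt hn)
    _ ≤ ENNReal.log (ENNReal.ofReal ((PerDvd n a).ncard * M ^ d)) / ((n - 2 * m : ℕ) : EReal) := by
      refine EReal.monotone_div_right_of_nonneg (Nat.cast_nonneg' _) (ENNReal.log_le_log ?_)
      have h2 : ENNReal.ofReal ((PerDvd n a).ncard * M ^ d)
          = (((PerDvd n a).ncard * M ^ d : ℕ) : ℝ≥0∞) := by
        rw [← ENNReal.ofReal_natCast]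
        push_cast
        rfl
      rw [h2, ← ENat.toENNReal_coe]
      refine ENat.toENNReal_mono ?_
      exact_mod_cast hcov
    _ = ((Real.log ((PerDvd n a).ncard * M ^ d) / ((n - 2 * m : ℕ) : ℝ) : ℝ) : EReal) := by
      rw [ENNReal.log_ofReal_of_pos (by positivity), EReal.coe_div]
      rfl
    _ ≤ _ := by
      simp only [Function.comp_apply, EReal.coe_le_coe_iff]
      gcongr
      rw [Real.log_mul hcardR.ne' (by positivity), Real.log_pow]
      have h3 : Real.log M ≤ Real.log C + d * Real.log n := by
        rw [← Real.log_pow, ← Real.log_mul (by positivity) (by positivity)]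
        exact Real.log_le_log hMR hMC
      have h4 : (d : ℝ) * Real.log M ≤ d * (Real.log C + d * Real.log n) := by gcongr
      linarith

open ExpGrowth in
/-- The entropy of the dual automorphism is the growth rate of the number of periodic points. -/
theorem IsDefining.entropy_eq_expGrowthSup {a : Label} {f : ℤ[X]} (hf : IsDefining a f) :
    entropy a = expGrowthSup fun n => ((PerDvd n a).encard : ℝ≥0∞) := by
  rw [entropy_eq]
  refine le_antisymm (iSup₂_le fun U hU => hf.coverEntropyEntourage_le hU) ?_
  obtain ⟨U, hU, h⟩ := hf.exists_encard_PerDvd_le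
  refine le_trans ?_ (Dynamics.netEntropyEntourage_le_coverEntropy (dualAut a) Set.univ hU)
  refine expGrowthSup_eventually_monotone ?_
  filter_upwards [eventually_gt_atTop 0] with n hn
  exact ENat.toENNReal_mono (h n hn)

/-! ### Representations of the full group C⋆-algebra -/

section GroupCStar

variable {G : Type} [Group G]

instance : CStarAlgebra (RepFamilies G) where

instance : IsClosed (groupCStar G : Set (RepFamilies G)) :=
  StarSubalgebra.isClosed_topologicalClosure _

instance : CStarAlgebra (groupCStar G) := StarSubalgebra.cstarAlgebra _

instance : SeminormedAddCommGroup (groupCStar G) :=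
  NonUnitalSeminormedRing.toSeminormedAddCommGroup

theorem norm_starAlgHom_apply_le {A : Type*} [CStarAlgebra A] (φ : groupCStar G →⋆ₐ[ℂ] A)
    (x : groupCStar G) : ‖φ x‖ ≤ ‖x‖ :=
  NonUnitalStarAlgHom.norm_apply_le φ x

theorem continuous_starAlgHom {A : Type*} [CStarAlgebra A] (φ : groupCStar G →⋆ₐ[ℂ] A) :
    Continuous φ :=
  AddMonoidHomClass.continuous_of_bound φ 1 fun x => by
    simpa using norm_starAlgHom_apply_le φ x

theorem canonicalUnitary_mul (g h : G) :
    canonicalUnitary (g * h) = canonicalUnitary g * canonicalUnitary h :=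
  lp.ext (funext fun π => by
    change ((π.toHom (g * h) : unitary (π.H →L[ℂ] π.H)) : π.H →L[ℂ] π.H) = _
    rw [map_mul]; rfl)

theorem canonicalUnitary_one : canonicalUnitary (1 : G) = 1 :=
  lp.ext (funext fun π => by
    change ((π.toHom 1 : unitary (π.H →L[ℂ] π.H)) : π.H →L[ℂ] π.H) = _
    rw [map_one]; rfl)

theorem star_canonicalUnitary (g : G) :
    star (canonicalUnitary g) = canonicalUnitary g⁻¹ :=
  lp.ext (funext fun π => by
    change star ((π.toHom g : unitary (π.H →L[ℂ] π.H)) : π.H →L[ℂ] π.H)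
      = ((π.toHom g⁻¹ : unitary (π.H →L[ℂ] π.H)) : π.H →L[ℂ] π.H)
    rw [map_inv]; rfl)

theorem canonicalUnitary_mem (g : G) : canonicalUnitary g ∈ groupCStar G :=
  StarSubalgebra.le_topologicalClosure _ (StarAlgebra.subset_adjoin ℂ _ ⟨g, rfl⟩)

/-- The canonical unitary of `g`, as an element of the group C⋆-algebra. -/
def canonical (g : G) : groupCStar G := ⟨canonicalUnitary g, canonicalUnitary_mem g⟩

theorem canonical_mul (g h : G) : canonical (g * h) = canonical g * canonical h :=
  Subtype.ext (canonicalUnitary_mul g h)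

theorem canonical_one : canonical (1 : G) = 1 := Subtype.ext canonicalUnitary_one

theorem star_canonical (g : G) : star (canonical g) = canonical g⁻¹ :=
  Subtype.ext (star_canonicalUnitary g)

theorem adjoin_le_span : ∀ x ∈ StarAlgebra.adjoin ℂ (Set.range (canonicalUnitary (G := G))),
    x ∈ Submodule.span ℂ (Set.range (canonicalUnitary (G := G))) := by
  intro x hx
  induction hx using StarAlgebra.adjoin_induction with
  | mem x hx => exact Submodule.subset_span hx
  | algebraMap r =>
    rw [Algebra.algebraMap_eq_smul_one, ← canonicalUnitary_one]
    exact Submodule.smul_mem _ _ (Submodule.subset_span ⟨1, rfl⟩)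
  | add x y _ _ hx hy => exact Submodule.add_mem _ hx hy
  | mul x y hx' hy' hx hy =>
    clear hx' hy'
    induction hx, hy using Submodule.span_induction₂ with
    | mem_mem x y hx hy =>
      obtain ⟨g, rfl⟩ := hx
      obtain ⟨h, rfl⟩ := hy
      exact Submodule.subset_span ⟨g * h, canonicalUnitary_mul g h⟩
    | zero_left y _ => rw [zero_mul]; exact Submodule.zero_mem _
    | zero_right x _ => rw [mul_zero]; exact Submodule.zero_mem _
    | add_left x y z _ _ _ h1 h2 => rw [add_mul]; exact Submodule.add_mem _ h1 h2
    | add_right x y z _ _ _ h1 h2 => rw [mul_add]; exact Submodule.add_mem _ h1 h2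
    | smul_left r x y _ _ h => rw [smul_mul_assoc]; exact Submodule.smul_mem _ _ h
    | smul_right r x y _ _ h => rw [mul_smul_comm]; exact Submodule.smul_mem _ _ h
  | star x hx' hx =>
    clear hx'
    induction hx using Submodule.span_induction with
    | mem x hx =>
      obtain ⟨g, rfl⟩ := hx
      exact Submodule.subset_span ⟨g⁻¹, (star_canonicalUnitary g).symm⟩
    | zero => rw [star_zero]; exact Submodule.zero_mem _
    | add x y _ _ hx hy => rw [star_add]; exact Submodule.add_mem _ hx hy
    | smul r x _ hx => rw [star_smul]; exact Submodule.smul_mem _ _ hx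

/-- The canonical unitaries are stable under products and adjoints, so their linear span is already
the ⋆-algebra they generate, and it is dense. -/
theorem groupCStar_induction {p : groupCStar G → Prop} (hclosed : IsClosed {x | p x})
    (hcan : ∀ g, p (canonical g)) (hadd : ∀ x y, p x → p y → p (x + y))
    (hsmul : ∀ (r : ℂ) x, p x → p (r • x)) (x : groupCStar G) : p x := by
  obtain ⟨C, hC, hCp⟩ := isClosed_induced_iff.1 hclosed
  have hp : ∀ x : groupCStar G, p x ↔ (x : RepFamilies G) ∈ C := fun x => by
    rw [← Set.mem_preimage, hCp]; rfl
  have hspan : ∀ y ∈ Submodule.span ℂ (Set.range (canonicalUnitary (G := G))),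
      ∃ h : y ∈ groupCStar G, p ⟨y, h⟩ := by
    intro y hy
    induction hy using Submodule.span_induction with
    | mem y hy =>
      obtain ⟨g, rfl⟩ := hy
      exact ⟨canonicalUnitary_mem g, hcan g⟩
    | zero =>
      refine ⟨zero_mem _, ?_⟩
      rw [show (⟨0, zero_mem _⟩ : groupCStar G) = (0 : ℂ) • canonical (1 : G) from
        Subtype.ext (zero_smul ℂ (canonicalUnitary (1 : G))).symm]
      exact hsmul 0 _ (hcan 1)
    | add y z _ _ hy hz => exact ⟨add_mem hy.1 hz.1, hadd _ _ hy.2 hz.2⟩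
    | smul r y _ hy => exact ⟨SMulMemClass.smul_mem r hy.1, hsmul r _ hy.2⟩
  rw [hp]
  have hx : (x : RepFamilies G) ∈ closure
      (StarAlgebra.adjoin ℂ (Set.range (canonicalUnitary (G := G))) : Set (RepFamilies G)) := x.2
  refine closure_minimal (t := C) (fun y hy => ?_) hC hx
  exact (hp _).1 (hspan y (adjoin_le_span y hy)).2

variable {H : Type} [NormedAddCommGroup H] [InnerProductSpace ℂ H] [CompleteSpace H]

/-- The representation of the group C⋆-algebra defined by a unitary representation. -/
def integrated [Nontrivial H] (ρ : G →* unitary (H →L[ℂ] H)) : groupCStar G →⋆ₐ[ℂ] (H →L[ℂ] H) where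
  toFun x := (x : RepFamilies G) ⟨H, ρ⟩
  map_one' := rfl
  map_mul' _ _ := rfl
  map_zero' := rfl
  map_add' _ _ := rfl
  commutes' _ := rfl
  map_star' _ := rfl

theorem integrated_canonical [Nontrivial H] (ρ : G →* unitary (H →L[ℂ] H)) (g : G) :
    integrated ρ (canonical g) = (ρ g : H →L[ℂ] H) := rfl

/-- The `⋆`-homomorphisms are contractive, so approximating `x` in norm approximates `φ p x`
uniformly in `p`. -/
theorem continuous_starAlgHom_family {P : Type*} [TopologicalSpace P]
    (φ : P → groupCStar G →⋆ₐ[ℂ] (H →L[ℂ] H)) (h : ∀ g, Continuous fun p => φ p (canonical g))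
    (x : groupCStar G) : Continuous fun p => φ p x := by
  induction x using groupCStar_induction with
  | hclosed =>
    refine isClosed_of_closure_subset fun x hx => ?_
    refine continuous_of_uniform_approx_of_continuous fun u hu => ?_
    obtain ⟨ε, hε, hεu⟩ := Metric.mem_uniformity_dist.1 hu
    obtain ⟨y, hy, hxy⟩ := Metric.mem_closure_iff.1 hx ε hε
    refine ⟨fun p => φ p y, hy, fun p => hεu ?_⟩
    rw [dist_eq_norm, ← map_sub]
    exact (norm_starAlgHom_apply_le _ _).trans_lt (by rwa [← dist_eq_norm])
  | hcan g => exact h g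
  | hadd x y hx hy => simp only [map_add]; exact hx.add hy
  | hsmul r x hx => simp only [map_smul]; exact hx.const_smul r

end GroupCStar

/-! ### Irreducible representations and their traces -/

section Irreducible

variable {A : Type*} [Ring A] [StarRing A] [Algebra ℂ A]
  {H : Type*} [NormedAddCommGroup H] [InnerProductSpace ℂ H] [CompleteSpace H]

/-- A representation is irreducible if its commutant is trivial. -/
def IsIrreducibleRep (φ : A →⋆ₐ[ℂ] (H →L[ℂ] H)) : Prop :=
  ∀ T : H →L[ℂ] H, (∀ x, T * φ x = φ x * T) → ∃ c : ℂ, T = c • 1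

/-- As `S` is closed under adjoints, the orthogonal complement of `W` is invariant too, so the
projection onto `W` commutes with `S` and is a scalar. -/
theorem eq_bot_or_eq_top_of_commutant_trivial [FiniteDimensional ℂ H] {S : Set (H →L[ℂ] H)}
    (hstar : ∀ s ∈ S, star s ∈ S)
    (hS : ∀ T : H →L[ℂ] H, (∀ s ∈ S, T * s = s * T) → ∃ c : ℂ, T = c • 1)
    (W : Submodule ℂ H) (hW : ∀ s ∈ S, ∀ w ∈ W, s w ∈ W) : W = ⊥ ∨ W = ⊤ := by
  have hperp : ∀ s ∈ S, ∀ w ∈ Wᗮ, s w ∈ Wᗮ := fun s hs w hw => by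
    rw [Submodule.mem_orthogonal]
    intro u hu
    rw [← ContinuousLinearMap.adjoint_inner_left, ← ContinuousLinearMap.star_eq_adjoint]
    exact (Submodule.mem_orthogonal W w).1 hw _ (hW _ (hstar s hs) _ hu)
  obtain ⟨c, hc⟩ := hS W.starProjection fun s hs => by
    ext v
    have h1 := hW s hs _ (W.starProjection_apply_mem v)
    have h2 := hperp s hs _ (W.sub_starProjection_mem_orthogonal v)
    have h3 : s v = s (W.starProjection v) + s (v - W.starProjection v) := by
      rw [← map_add, add_sub_cancel]
    change W.starProjection (s v) = s (W.starProjection v)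
    rw [h3, map_add, Submodule.starProjection_eq_self_iff.2 h1,
      (Submodule.starProjection_apply_eq_zero_iff W).2 h2, add_zero]
  rw [or_iff_not_imp_left]
  intro hne
  obtain ⟨w, hw, hw0⟩ := W.exists_mem_ne_zero_of_ne_bot hne
  have h1 : W.starProjection w = w := Submodule.starProjection_eq_self_iff.2 hw
  have hc1 : c = 1 := by
    rw [hc] at h1
    have : (c - 1) • w = 0 := by
      rw [sub_smul, one_smul, sub_eq_zero]
      exact h1
    exact sub_eq_zero.1 ((smul_eq_zero.1 this).resolve_right hw0)
  rw [eq_top_iff]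
  intro v _
  rw [← Submodule.starProjection_eq_self_iff, hc, hc1, one_smul]
  rfl

theorem IsIrreducibleRep.eq_bot_or_eq_top [FiniteDimensional ℂ H] {φ : A →⋆ₐ[ℂ] (H →L[ℂ] H)}
    (hφ : IsIrreducibleRep φ) (W : Submodule ℂ H) (hW : ∀ x, ∀ w ∈ W, φ x w ∈ W) :
    W = ⊥ ∨ W = ⊤ := by
  refine eq_bot_or_eq_top_of_commutant_trivial (S := Set.range φ) ?_
    (fun T hT => hφ T fun x => hT _ ⟨x, rfl⟩) W ?_
  · rintro _ ⟨x, rfl⟩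
    exact ⟨star x, map_star φ x⟩
  · rintro _ ⟨x, rfl⟩
    exact hW x

/-- The traces of the irreducible representations of dimension `q`. -/
def irreducibleTraces (A : Type*) [Ring A] [StarRing A] [Algebra ℂ A] (q : ℕ) [NeZero q] :
    Set (A → ℂ) :=
  {τ | ∃ φ : A →⋆ₐ[ℂ] (EuclideanSpace ℂ (ZMod q) →L[ℂ] EuclideanSpace ℂ (ZMod q)),
    IsIrreducibleRep φ ∧ τ = fun x => LinearMap.trace ℂ _ (φ x).toLinearMap}

theorem comp_mem_irreducibleTraces {A' : Type*} [Ring A'] [StarRing A'] [Algebra ℂ A']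
    (e : A ≃⋆ₐ[ℂ] A') {q : ℕ} [NeZero q] {τ : A' → ℂ} (hτ : τ ∈ irreducibleTraces A' q) :
    τ ∘ e ∈ irreducibleTraces A q := by
  obtain ⟨φ, hφ, rfl⟩ := hτ
  refine ⟨φ.comp (e : A →⋆ₐ[ℂ] A'), fun T hT => hφ T fun x => ?_, rfl⟩
  obtain ⟨y, rfl⟩ := e.surjective x
  exact hT y

/-- A `⋆`-isomorphism identifies the spaces of irreducible traces (with the topology of pointwise
convergence). -/
def irreducibleTracesHomeomorph {A' : Type*} [Ring A'] [StarRing A'] [Algebra ℂ A']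
    (e : A ≃⋆ₐ[ℂ] A') (q : ℕ) [NeZero q] : irreducibleTraces A q ≃ₜ irreducibleTraces A' q where
  toFun τ := ⟨τ.1 ∘ e.symm, comp_mem_irreducibleTraces e.symm τ.2⟩
  invFun τ := ⟨τ.1 ∘ e, comp_mem_irreducibleTraces e τ.2⟩
  left_inv τ := Subtype.ext (funext fun x => congrArg τ.1 (e.symm_apply_apply x))
  right_inv τ := Subtype.ext (funext fun x => congrArg τ.1 (e.apply_symm_apply x))
  continuous_toFun := Continuous.subtype_mk
    (continuous_pi fun x => (continuous_apply (e.symm x)).comp continuous_subtype_val :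
      Continuous fun τ : irreducibleTraces A q => τ.1 ∘ e.symm) _
  continuous_invFun := Continuous.subtype_mk
    (continuous_pi fun x => (continuous_apply (e x)).comp continuous_subtype_val :
      Continuous fun τ : irreducibleTraces A' q => τ.1 ∘ e) _

end Irreducible

/-! ### Orbits of the dual automorphism -/

open Multiplicative (ofAdd toAdd)

theorem dualAut_iterate_apply {a : Label} (χ : dualGroup a) (j : ℕ) (b : Multiplicative (B a)) :
    ((dualAut a)^[j] χ) b = χ (action a (ofAdd (j : ℤ)) b) := by
  induction j generalizing b with
  | zero => simp
  | succ j ih =>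
    rw [Function.iterate_succ_apply', dualAut_apply, ih, Nat.cast_succ, ofAdd_add, map_mul,
      MulAut.mul_apply]
    congr 2

theorem mem_PerDvd_iff_apply {a : Label} {q : ℕ} {χ : dualGroup a} :
    χ ∈ PerDvd q a ↔ ∀ b, χ (action a (ofAdd (q : ℤ)) b) = χ b := by
  simp only [← dualAut_iterate_apply]
  exact ⟨fun h k => by rw [show (dualAut a)^[q] χ = χ from h], fun h => PontryaginDual.ext h⟩

theorem PerDvd_apply_action {a : Label} {q : ℕ} {χ : dualGroup a} (h : χ ∈ PerDvd q a) (n j : ℤ)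
    (b : Multiplicative (B a)) :
    χ (action a (ofAdd (n + q * j)) b) = χ (action a (ofAdd n) b) := by
  have hq : ∀ n, χ (action a (ofAdd (n + q)) b) = χ (action a (ofAdd n) b) := fun n => by
    rw [add_comm, ofAdd_add, map_mul, MulAut.mul_apply, mem_PerDvd_iff_apply.1 h]
  induction j using Int.induction_on with
  | zero => simp
  | succ j ih => rw [← ih, mul_add_one, ← add_assoc, hq]
  | pred j ih => rw [← ih, ← hq]; congr 4; ring

section Orbit

variable {a : Label} {q : ℕ} [NeZero q]

/-- The orbit of a point of period `q`, indexed by residues modulo `q`. -/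
def orb (χ : dualGroup a) (k : ZMod q) : dualGroup a := (dualAut a)^[k.val] χ

theorem orb_intCast {χ : dualGroup a} (h : χ ∈ PerDvd q a) (n : ℤ) (b : Multiplicative (B a)) :
    orb χ (n : ZMod q) b = χ (action a (ofAdd n) b) := by
  rw [orb, dualAut_iterate_apply, ZMod.val_intCast, ← PerDvd_apply_action h (n % q) (n / q),
    Int.emod_add_mul_ediv]

theorem orb_action {χ : dualGroup a} (h : χ ∈ PerDvd q a) (k : ZMod q) (n : ℤ)
    (b : Multiplicative (B a)) : orb χ k (action a (ofAdd n) b) = orb χ (k + (n : ZMod q)) b := by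
  obtain ⟨k, rfl⟩ := ZMod.intCast_surjective k
  rw [← Int.cast_add, orb_intCast h, orb_intCast h, ofAdd_add, map_mul, MulAut.mul_apply]

theorem Per_subset_PerDvd (q : ℕ) (a : Label) : Per q a ⊆ PerDvd q a := fun _ h => h.2

theorem orb_zero {q : ℕ} (χ : dualGroup a) : orb χ (0 : ZMod q) = χ := by simp [orb]

theorem orb_injective {χ : dualGroup a} (h : χ ∈ Per q a) :
    Function.Injective fun k : ZMod q => orb χ k := by
  have key : ∀ k l : ZMod q, k.val < l.val → orb χ k ≠ orb χ l := by
    intro k l hkl hkl'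
    have hl := ZMod.val_lt l
    refine h.1 (l.val - k.val) (by omega) (by omega) ?_
    refine ((dualAut a).injective.iterate k.val ?_).symm
    rw [← Function.iterate_add_apply, show k.val + (l.val - k.val) = l.val by omega]
    exact hkl'
  intro k l hkl
  by_contra hne
  rcases lt_or_gt_of_ne (fun h => hne (ZMod.val_injective q h) : k.val ≠ l.val) with h1 | h1
  · exact key k l h1 hkl
  · exact key l k h1 hkl.symm

end Orbit

/-! ### The cyclic representations -/

section Cyclic

variable {a : Label} {q : ℕ} [NeZero q]

/-- The operator `f ↦ (k ↦ ζ ^ n χ(aⁿ b) f (k + n))` of the element `(b, n)` of `G_a`. -/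
def cyclicOp (χ : dualGroup a) (ζ : Circle) (g : G a) :
    EuclideanSpace ℂ (ZMod q) →ₗᵢ[ℂ] EuclideanSpace ℂ (ZMod q) where
  toFun f := WithLp.toLp 2 fun k =>
    ((ζ ^ toAdd g.right * orb χ k g.left : Circle) : ℂ) * f (k + ((toAdd g.right : ℤ) : ZMod q))
  map_add' f f' := by ext k; simp [mul_add]
  map_smul' c f := by ext k; simp; ring
  norm_map' f := by
    change ‖(WithLp.toLp 2 fun k => _ : EuclideanSpace ℂ (ZMod q))‖ = _
    rw [EuclideanSpace.norm_eq, EuclideanSpace.norm_eq]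
    simp only [norm_mul, Circle.norm_coe, one_mul]
    exact congrArg _ (Equiv.sum_comp (Equiv.addRight ((toAdd g.right : ℤ) : ZMod q))
      fun k => ‖f k‖ ^ 2)

theorem cyclicOp_apply (χ : dualGroup a) (ζ : Circle) (g : G a) (f : EuclideanSpace ℂ (ZMod q))
    (k : ZMod q) : cyclicOp χ ζ g f k =
      ((ζ ^ toAdd g.right * orb χ k g.left : Circle) : ℂ) *
        f (k + ((toAdd g.right : ℤ) : ZMod q)) := rfl

theorem cyclicOp_mul {χ : dualGroup a} (hχ : χ ∈ PerDvd q a) (ζ : Circle) (g h : G a)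
    (f : EuclideanSpace ℂ (ZMod q)) :
    cyclicOp χ ζ (g * h) f = cyclicOp χ ζ g (cyclicOp χ ζ h f) := by
  ext k
  have h1 := orb_action hχ k (toAdd g.right) h.left
  rw [cyclicOp_apply, cyclicOp_apply, cyclicOp_apply, ← h1, SemidirectProduct.mul_left,
    SemidirectProduct.mul_right, toAdd_mul, map_mul, zpow_add, Int.cast_add, add_assoc]
  simp only [Circle.coe_mul, ofAdd_toAdd]
  ring

theorem cyclicOp_one (χ : dualGroup a) (ζ : Circle) (f : EuclideanSpace ℂ (ZMod q)) :
    cyclicOp χ ζ (1 : G a) f = f := by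
  ext k
  simp [cyclicOp_apply]

theorem cyclicOp_mem_unitary {χ : dualGroup a} (hχ : χ ∈ PerDvd q a) (ζ : Circle) (g : G a) :
    (cyclicOp χ ζ g).toContinuousLinearMap ∈
      unitary (EuclideanSpace ℂ (ZMod q) →L[ℂ] EuclideanSpace ℂ (ZMod q)) := by
  set U := (cyclicOp (q := q) χ ζ g).toContinuousLinearMap
  have h1 : star U * U = 1 :=
    (ContinuousLinearMap.norm_map_iff_adjoint_comp_self U).1 (cyclicOp χ ζ g).norm_map
  have h2 : U * (cyclicOp χ ζ g⁻¹).toContinuousLinearMap = 1 := by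
    refine ContinuousLinearMap.ext fun f => ?_
    change cyclicOp χ ζ g (cyclicOp χ ζ g⁻¹ f) = f
    rw [← cyclicOp_mul hχ, mul_inv_cancel, cyclicOp_one]
  refine Unitary.mem_iff.2 ⟨h1, ?_⟩
  rw [← left_inv_eq_right_inv h1 h2] at h2
  exact h2

/-- The cyclic representation of `G_a` on `ℂ ^ q`. -/
def cyclicRep (χ : PerDvd q a) (ζ : Circle) :
    G a →* unitary (EuclideanSpace ℂ (ZMod q) →L[ℂ] EuclideanSpace ℂ (ZMod q)) :=
  MonoidHom.mk' (fun g => ⟨(cyclicOp χ.1 ζ g).toContinuousLinearMap, cyclicOp_mem_unitary χ.2 ζ g⟩)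
    fun g h => Subtype.ext (ContinuousLinearMap.ext (cyclicOp_mul χ.2 ζ g h))

theorem cyclicRep_apply (χ : PerDvd q a) (ζ : Circle) (g : G a) (f : EuclideanSpace ℂ (ZMod q))
    (k : ZMod q) :
    (cyclicRep χ ζ g : EuclideanSpace ℂ (ZMod q) →L[ℂ] EuclideanSpace ℂ (ZMod q)) f k =
      ((ζ ^ toAdd g.right * orb χ.1 k g.left : Circle) : ℂ) *
        f (k + ((toAdd g.right : ℤ) : ZMod q)) := rfl

/-- Exact period `q` makes the characters of `B_a` on the basis vectors pairwise distinct, so `T` is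
diagonal; the generator of `ℤ` permutes the basis cyclically up to phase, so the diagonal is
constant. -/
theorem eq_smul_one_of_commute_cyclicRep (χ : PerDvd q a) (hχ : χ.1 ∈ Per q a) (ζ : Circle)
    (T : EuclideanSpace ℂ (ZMod q) →L[ℂ] EuclideanSpace ℂ (ZMod q))
    (hT : ∀ g, T * cyclicRep χ ζ g = cyclicRep χ ζ g * T) : ∃ c : ℂ, T = c • 1 := by
  have hT' : ∀ g f, T ((cyclicRep χ ζ g : EuclideanSpace ℂ (ZMod q) →L[ℂ] _) f)
      = (cyclicRep χ ζ g : EuclideanSpace ℂ (ZMod q) →L[ℂ] _) (T f) :=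
    fun g f => DFunLike.congr_fun (hT g) f
  set e : ZMod q → EuclideanSpace ℂ (ZMod q) := fun k => EuclideanSpace.single k 1 with he
  have hdiag : ∀ k l, l ≠ k → T (e k) l = 0 := by
    intro k l hlk
    obtain ⟨b, hb⟩ : ∃ b, orb χ.1 l b ≠ orb χ.1 k b := by
      by_contra! hcon
      exact hlk (orb_injective hχ (PontryaginDual.ext hcon))
    have h1 := hT' (SemidirectProduct.inl b) (e k)
    have h2 : (cyclicRep χ ζ (SemidirectProduct.inl b) : EuclideanSpace ℂ (ZMod q) →L[ℂ] _) (e k)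
        = (orb χ.1 k b : ℂ) • e k := by
      ext j
      rw [cyclicRep_apply]
      by_cases hj : j = k
      · subst hj; simp [he]
      · simp [he, hj]
    have h3 := congrArg (fun f : EuclideanSpace ℂ (ZMod q) => f l) h1
    simp only [h2, map_smul, cyclicRep_apply, PiLp.smul_apply, smul_eq_mul,
      SemidirectProduct.left_inl, SemidirectProduct.right_inl, toAdd_one, zpow_zero, one_mul,
      Int.cast_zero, add_zero] at h3
    by_contra hne
    exact hb (Circle.ext (mul_right_cancel₀ hne h3)).symm
  have hstep : ∀ k, T (e (k + 1)) (k + 1) = T (e k) k := by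
    intro k
    have h1 := hT' (SemidirectProduct.inr (ofAdd 1)) (e (k + 1))
    have h2 : (cyclicRep χ ζ (SemidirectProduct.inr (ofAdd 1)) : EuclideanSpace ℂ (ZMod q) →L[ℂ] _)
        (e (k + 1)) = (ζ : ℂ) • e k := by
      ext j
      rw [cyclicRep_apply]
      by_cases hj : j = k
      · subst hj; simp [he]
      · simp [he, hj]
    have h3 := congrArg (fun f : EuclideanSpace ℂ (ZMod q) => f k) h1
    simp only [h2, map_smul, cyclicRep_apply, PiLp.smul_apply, smul_eq_mul,
      SemidirectProduct.left_inr, SemidirectProduct.right_inr, toAdd_ofAdd, zpow_one, map_one,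
      mul_one, Int.cast_one] at h3
    exact (mul_left_cancel₀ ζ.coe_ne_zero h3).symm
  have hconst : ∀ k, T (e k) k = T (e 0) 0 := by
    intro k
    obtain ⟨n, rfl⟩ := ZMod.natCast_zmod_surjective k
    induction n with
    | zero => simp
    | succ n ih => rw [Nat.cast_succ, hstep, ih]
  refine ⟨T (e 0) 0, ?_⟩
  apply ContinuousLinearMap.coe_injective
  refine (EuclideanSpace.basisFun (ZMod q) ℂ).toBasis.ext fun k => ?_
  simp only [OrthonormalBasis.coe_toBasis, EuclideanSpace.basisFun_apply]
  change T (e k) = T (e 0) 0 • e k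
  ext l
  by_cases hl : l = k
  · subst hl
    rw [hconst l]
    simp [he]
  · rw [hdiag k l hl]
    simp [he, hl]

end Cyclic

/-! ### Classification of the irreducible representations of `G_a` -/

section UnitaryGroupRep

variable {M : Type*} [Group M] {H : Type*} [NormedAddCommGroup H] [InnerProductSpace ℂ H]
  [CompleteSpace H] (R : M →* unitary (H →L[ℂ] H))

theorem unitaryRep_mul_apply (g h : M) (v : H) :
    (R (g * h) : H →L[ℂ] H) v = (R g : H →L[ℂ] H) ((R h : H →L[ℂ] H) v) := by
  rw [map_mul]; rfl

theorem unitaryRep_one_apply (v : H) : (R 1 : H →L[ℂ] H) v = v := by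
  rw [map_one]; rfl

theorem unitaryRep_inner (g : M) (v w : H) :
    inner ℂ ((R g : H →L[ℂ] H) v) ((R g : H →L[ℂ] H) w) = inner ℂ v w := by
  rw [← ContinuousLinearMap.adjoint_inner_left, ← ContinuousLinearMap.star_eq_adjoint,
    ← mul_apply_eq_comp, Unitary.star_mul_self_of_mem (R g).2]
  rfl

theorem unitaryRep_norm (g : M) (v : H) : ‖(R g : H →L[ℂ] H) v‖ = ‖v‖ := by
  rw [@norm_eq_sqrt_re_inner ℂ, @norm_eq_sqrt_re_inner ℂ _ _ _ _ v, unitaryRep_inner]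

theorem unitaryRep_ne_zero (g : M) {v : H} (hv : v ≠ 0) : (R g : H →L[ℂ] H) v ≠ 0 := by
  rwa [← norm_ne_zero_iff, unitaryRep_norm, norm_ne_zero_iff]

theorem norm_eq_one_of_unitaryRep_apply_eq_smul {g : M} {v : H} (hv : v ≠ 0) {c : ℂ}
    (h : (R g : H →L[ℂ] H) v = c • v) : ‖c‖ = 1 := by
  have h1 := unitaryRep_norm R g v
  rw [h, norm_smul] at h1
  exact (mul_eq_right₀ (norm_ne_zero_iff.2 hv)).1 h1

end UnitaryGroupRep

/-- On a minimal nonzero invariant subspace every operator is a scalar, because its eigenspaces are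
invariant under the commuting operators. Unitarity puts the scalars on the circle. -/
theorem exists_joint_eigenvector {M : Type*} [CommGroup M] {H : Type*} [NormedAddCommGroup H]
    [InnerProductSpace ℂ H] [CompleteSpace H] [FiniteDimensional ℂ H] [Nontrivial H]
    (R : M →* unitary (H →L[ℂ] H)) :
    ∃ χ : M →* Circle, ∃ v : H, v ≠ 0 ∧ ∀ b, (R b : H →L[ℂ] H) v = (χ b : ℂ) • v := by
  let S : Set (Submodule ℂ H) := {W | W ≠ ⊥ ∧ ∀ b, ∀ w ∈ W, (R b : H →L[ℂ] H) w ∈ W}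
  obtain ⟨W, ⟨hW, hWR⟩, hmin⟩ := (wellFounded_lt (α := Submodule ℂ H)).has_min S
    ⟨⊤, top_ne_bot, fun _ _ _ => trivial⟩
  have hscalar : ∀ b, ∃ c : ℂ, ∀ w ∈ W, (R b : H →L[ℂ] H) w = c • w := by
    intro b
    have : Nontrivial W := Submodule.nontrivial_iff_ne_bot.2 hW
    obtain ⟨c, hc⟩ := Module.End.exists_eigenvalue
      ((R b : H →L[ℂ] H).toLinearMap.restrict (p := W) (q := W) (hWR b))
    obtain ⟨w, hw⟩ := hc.exists_hasEigenvector
    let E : Submodule ℂ H := W ⊓ Module.End.eigenspace (R b : H →L[ℂ] H).toLinearMap c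
    have hE : E ∈ S := by
      refine ⟨fun hbot => ?_, fun b' x hx => ⟨hWR b' x hx.1, ?_⟩⟩
      · have hwE : (w : H) ∈ E := ⟨w.2, Module.End.mem_eigenspace_iff.2
          (congrArg Subtype.val hw.apply_eq_smul)⟩
        rw [hbot, Submodule.mem_bot] at hwE
        exact hw.2 (Subtype.ext hwE)
      · have hx' : (R b : H →L[ℂ] H) x = c • x := Module.End.mem_eigenspace_iff.1 hx.2
        refine Module.End.mem_eigenspace_iff.2 ?_
        change (R b : H →L[ℂ] H) ((R b' : H →L[ℂ] H) x) = c • (R b' : H →L[ℂ] H) x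
        rw [← unitaryRep_mul_apply, mul_comm, unitaryRep_mul_apply, hx', map_smul]
    have hEW : E = W := eq_of_le_of_not_lt inf_le_left (hmin E hE)
    refine ⟨c, fun w hw => Module.End.mem_eigenspace_iff.1 (?_ : w ∈ E).2⟩
    rwa [hEW]
  obtain ⟨v, hv, hv0⟩ := W.exists_mem_ne_zero_of_ne_bot hW
  choose c hc using hscalar
  have hcirc : ∀ b, ∃ z : Circle, (R b : H →L[ℂ] H) v = (z : ℂ) • v := fun b =>
    ⟨⟨c b, mem_sphere_zero_iff_norm.2
      (norm_eq_one_of_unitaryRep_apply_eq_smul R hv0 (hc b v hv))⟩, hc b v hv⟩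
  choose χ hχ using hcirc
  have hinj : ∀ z z' : Circle, (z : ℂ) • v = (z' : ℂ) • v → z = z' := fun z z' h =>
    Circle.ext (smul_left_injective ℂ hv0 h)
  refine ⟨⟨⟨χ, hinj _ _ ?_⟩, fun b b' => hinj _ _ ?_⟩, v, hv0, hχ⟩
  · rw [← hχ, unitaryRep_one_apply, Circle.coe_one, one_smul]
  · rw [← hχ, unitaryRep_mul_apply, hχ b', map_smul, hχ b, smul_smul, Circle.coe_mul, mul_comm]

theorem Circle.exists_pow_eq (z : Circle) {n : ℕ} (hn : n ≠ 0) : ∃ w : Circle, w ^ n = z := by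
  refine ⟨Circle.exp (Complex.arg z / n), ?_⟩
  rw [← Circle.exp_natCast_mul, mul_div_cancel₀ _ (by exact_mod_cast hn), Circle.exp_arg]

theorem inl_mul_inr_neg (a : Label) (b : Multiplicative (B a)) (n : ℤ) :
    (SemidirectProduct.inl b * SemidirectProduct.inr (ofAdd (-n)) : G a)
      = SemidirectProduct.inr (ofAdd (-n)) * SemidirectProduct.inl (action a (ofAdd n) b) := by
  rw [SemidirectProduct.inl_aut, ofAdd_neg]
  simp [mul_assoc]

section Classification

variable {a : Label} {H : Type*} [NormedAddCommGroup H] [InnerProductSpace ℂ H]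
  [CompleteSpace H] (R : G a →* unitary (H →L[ℂ] H))

theorem inl_apply_inr_neg_apply {χ : dualGroup a} {v : H}
    (hv : ∀ b, (R (SemidirectProduct.inl b) : H →L[ℂ] H) v = (χ b : ℂ) • v) (n : ℤ)
    (b : Multiplicative (B a)) :
    (R (SemidirectProduct.inl b) : H →L[ℂ] H)
        ((R (SemidirectProduct.inr (ofAdd (-n))) : H →L[ℂ] H) v)
      = (χ (action a (ofAdd n) b) : ℂ) •
        (R (SemidirectProduct.inr (ofAdd (-n))) : H →L[ℂ] H) v := by
  rw [← unitaryRep_mul_apply, inl_mul_inr_neg, unitaryRep_mul_apply, hv, map_smul]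

/-- The translates of `v` under `ℤ` are eigenvectors for the iterates of `χ`. Distinct characters
have orthogonal eigenvectors, so an infinite orbit would contradict finite dimension. -/
theorem exists_mem_PerDvd_of_eigenvector [FiniteDimensional ℂ H] {χ : dualGroup a} {v : H}
    (hv0 : v ≠ 0) (hv : ∀ b, (R (SemidirectProduct.inl b) : H →L[ℂ] H) v = (χ b : ℂ) • v) :
    ∃ p : ℕ, 0 < p ∧ χ ∈ PerDvd p a := by
  by_contra! hcon
  have hdist : ∀ i j : ℕ, i < j → (dualAut a)^[i] χ ≠ (dualAut a)^[j] χ := by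
    intro i j hij h
    refine hcon (j - i) (by omega) ?_
    refine ((dualAut a).injective.iterate i ?_).symm
    rw [← Function.iterate_add_apply, show i + (j - i) = j by omega]
    exact h
  let w : ℕ → H := fun n => (R (SemidirectProduct.inr (ofAdd (-(n : ℤ)))) : H →L[ℂ] H) v
  have horth : Pairwise fun i j => inner ℂ (w i) (w j) = 0 := by
    intro i j hij
    obtain ⟨b, hb⟩ : ∃ b, ((dualAut a)^[i] χ) b ≠ ((dualAut a)^[j] χ) b := by
      by_contra! h
      rcases lt_or_gt_of_ne hij with h1 | h1
      · exact hdist i j h1 (PontryaginDual.ext h)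
      · exact hdist j i h1 (PontryaginDual.ext fun b => (h b).symm)
    rw [dualAut_iterate_apply, dualAut_iterate_apply] at hb
    have h1 := unitaryRep_inner R (SemidirectProduct.inl b) (w i) (w j)
    rw [inl_apply_inr_neg_apply R hv, inl_apply_inr_neg_apply R hv, inner_smul_left,
      inner_smul_right, ← mul_assoc] at h1
    by_contra hne
    have h2 := (mul_eq_right₀ hne).1 h1
    rw [← Circle.coe_inv_eq_conj, ← Circle.coe_mul, ← Circle.coe_one, Circle.coe_inj,
      inv_mul_eq_one] at h2
    exact hb h2
  exact Module.Finite.not_linearIndependent_of_infinite w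
    (linearIndependent_of_ne_zero_of_inner_eq_zero (fun i => unitaryRep_ne_zero R _ hv0) horth)

theorem exists_cyclic_vector [FiniteDimensional ℂ H] [Nontrivial H] :
    ∃ (p : ℕ) (_ : NeZero p) (χ : PerDvd p a) (ζ : Circle) (v : H), χ.1 ∈ Per p a ∧ v ≠ 0 ∧
      (∀ b, (R (SemidirectProduct.inl b) : H →L[ℂ] H) v = (χ.1 b : ℂ) • v) ∧
      (R (SemidirectProduct.inr (ofAdd (-(p : ℤ)))) : H →L[ℂ] H) v = ((ζ ^ (-(p : ℤ)) : Circle) : ℂ) • v := by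
  classical
  obtain ⟨χ₀, v, hv0, hv⟩ := exists_joint_eigenvector (R.comp SemidirectProduct.inl)
  let χ : dualGroup a := (⟨χ₀, continuous_of_discreteTopology⟩ : Multiplicative (B a) →ₜ* Circle)
  have hv : ∀ b, (R (SemidirectProduct.inl b) : H →L[ℂ] H) v = (χ b : ℂ) • v := hv
  have hper := exists_mem_PerDvd_of_eigenvector R hv0 hv
  let p := Nat.find hper
  obtain ⟨hp, hχ⟩ : 0 < p ∧ χ ∈ PerDvd p a := Nat.find_spec hper
  have : NeZero p := ⟨hp.ne'⟩
  have hχp : χ ∈ Per p a := ⟨fun k hk hkp h => Nat.find_min hper hkp ⟨hk, h⟩, hχ⟩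
  -- Since `χ` has period `p`, its joint eigenspace is stable under the translation by `-p` and
  -- contains an eigenvector of it.
  let E : Submodule ℂ H := ⨅ b, Module.End.eigenspace
    (R (SemidirectProduct.inl b) : H →L[ℂ] H).toLinearMap (χ b : ℂ)
  have hE : ∀ w, w ∈ E ↔ ∀ b, (R (SemidirectProduct.inl b) : H →L[ℂ] H) w = (χ b : ℂ) • w := by
    intro w
    simp only [E, Submodule.mem_iInf, Module.End.mem_eigenspace_iff]
    rfl
  have hmap : ∀ w ∈ E, (R (SemidirectProduct.inr (ofAdd (-(p : ℤ)))) : H →L[ℂ] H) w ∈ E := by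
    intro w hw
    rw [hE] at hw ⊢
    intro b
    rw [inl_apply_inr_neg_apply R hw, mem_PerDvd_iff_apply.1 hχ]
  have : Nontrivial E := Submodule.nontrivial_iff_ne_bot.2 fun h => hv0 (by
    rw [← Submodule.mem_bot (R := ℂ), ← h, hE]; exact hv)
  obtain ⟨c, hc⟩ := Module.End.exists_eigenvalue
    ((R (SemidirectProduct.inr (ofAdd (-(p : ℤ)))) : H →L[ℂ] H).toLinearMap.restrict
      (p := E) (q := E) hmap)
  obtain ⟨w, hw⟩ := hc.exists_hasEigenvector
  have hw0 : (w : H) ≠ 0 := fun h => hw.2 (Subtype.ext h)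
  have hwc : (R (SemidirectProduct.inr (ofAdd (-(p : ℤ)))) : H →L[ℂ] H) w = c • (w : H) :=
    congrArg Subtype.val hw.apply_eq_smul
  obtain ⟨z, hz⟩ : ∃ z : Circle, (z : ℂ) = c := ⟨⟨c, mem_sphere_zero_iff_norm.2
    (norm_eq_one_of_unitaryRep_apply_eq_smul R hw0 hwc)⟩, rfl⟩
  -- A `p`-th root spreads the eigenvalue evenly over the orbit, one factor `ζ` per step.
  obtain ⟨ζ, hζ⟩ := Circle.exists_pow_eq z⁻¹ hp.ne'
  refine ⟨p, inferInstance, ⟨χ, hχ⟩, ζ, w, hχp, hw0, (hE w).1 w.2, ?_⟩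
  rw [hwc, zpow_neg, zpow_natCast, hζ, inv_inv, hz]

/-- The vectors `ζ ^ n • V (-n) v` depend only on `n` modulo `p` and define an intertwiner `P` from
the cyclic representation. As in Schur's lemma, its kernel and range are invariant for irreducible
representations, and `P` is nonzero. -/
theorem exists_equiv_cyclicRep [FiniteDimensional ℂ H] [Nontrivial H]
    (hirr : ∀ W : Submodule ℂ H, (∀ g, ∀ w ∈ W, (R g : H →L[ℂ] H) w ∈ W) → W = ⊥ ∨ W = ⊤) :
    ∃ (p : ℕ) (_ : NeZero p) (χ : PerDvd p a) (ζ : Circle)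
      (P : EuclideanSpace ℂ (ZMod p) ≃ₗ[ℂ] H), χ.1 ∈ Per p a ∧ ∀ g f, (R g : H →L[ℂ] H) (P f)
        = P ((cyclicRep χ ζ g : EuclideanSpace ℂ (ZMod p) →L[ℂ] EuclideanSpace ℂ (ZMod p)) f) := by
  obtain ⟨p, _, χ, ζ, v, hχ, hv0, hv, hvp⟩ := exists_cyclic_vector R
  let V : ℤ → H →L[ℂ] H := fun n => R (SemidirectProduct.inr (ofAdd n))
  have hV : ∀ m n x, V (m + n) x = V m (V n x) := fun m n x => by
    simp only [V, ofAdd_add, map_mul]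
    rfl
  let e : ℤ → H := fun n => ((ζ ^ n : Circle) : ℂ) • V (-n) v
  have hep : ∀ n j : ℤ, e (n + p * j) = e n := by
    have h1 : ∀ n : ℤ, e (n + p) = e n := fun n => by
      simp only [e]
      rw [neg_add, hV, show V (-p) v = _ from hvp, map_smul, smul_smul, ← Circle.coe_mul,
        ← zpow_add, add_neg_cancel_right]
    intro n j
    induction j using Int.induction_on with
    | zero => simp
    | succ j ih => rw [← ih, mul_add_one, ← add_assoc, h1]
    | pred j ih => rw [← ih, ← h1]; congr 1; ring
  let w : ZMod p → H := fun k => e k.val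
  have hw : ∀ n : ℤ, w (n : ZMod p) = e n := fun n => by
    simp only [w]
    rw [ZMod.val_intCast, ← hep (n % p) (n / p), Int.emod_add_mul_ediv]
  have hwV : ∀ (k : ZMod p) (n : ℤ), V n (w k) = ((ζ ^ n : Circle) : ℂ) • w (k - (n : ZMod p)) := by
    intro k n
    obtain ⟨k, rfl⟩ := ZMod.intCast_surjective k
    rw [← Int.cast_sub, hw, hw]
    simp only [e]
    rw [map_smul, ← hV, smul_smul, ← Circle.coe_mul, ← zpow_add]
    congr 3 <;> ring
  have hwb : ∀ (k : ZMod p) b, (R (SemidirectProduct.inl b) : H →L[ℂ] H) (w k)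
      = (orb χ.1 k b : ℂ) • w k := by
    intro k b
    obtain ⟨k, rfl⟩ := ZMod.intCast_surjective k
    rw [hw, orb_intCast χ.2]
    simp only [e]
    rw [map_smul]
    simp only [V]
    rw [inl_apply_inr_neg_apply R hv, smul_comm]
  let P : EuclideanSpace ℂ (ZMod p) →ₗ[ℂ] H :=
    { toFun := fun f => ∑ k, f k • w k
      map_add' := fun f f' => by simp [add_smul, Finset.sum_add_distrib]
      map_smul' := fun c f => by simp [mul_smul, Finset.smul_sum] }
  have hP : ∀ g f, (R g : H →L[ℂ] H) (P f)
      = P ((cyclicRep χ ζ g : EuclideanSpace ℂ (ZMod p) →L[ℂ] EuclideanSpace ℂ (ZMod p)) f) := by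
    intro g f
    change (R g : H →L[ℂ] H) (∑ k, f k • w k) = ∑ k, _ • w k
    rw [map_sum, ← Equiv.sum_comp (Equiv.addRight ((toAdd g.right : ℤ) : ZMod p))]
    refine Finset.sum_congr rfl fun k _ => ?_
    rw [cyclicRep_apply, Equiv.coe_addRight, map_smul]
    have h0 : ∀ x, (R g : H →L[ℂ] H) x = (R (SemidirectProduct.inl g.left) : H →L[ℂ] H)
        ((R (SemidirectProduct.inr g.right) : H →L[ℂ] H) x) := fun x => by
      rw [← unitaryRep_mul_apply, SemidirectProduct.inl_left_mul_inr_right]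
    have h1 := hwV (k + ((toAdd g.right : ℤ) : ZMod p)) (toAdd g.right)
    simp only [V, ofAdd_toAdd] at h1
    rw [h0, h1, map_smul, add_sub_cancel_right, hwb, smul_smul, smul_smul, Circle.coe_mul]
    congr 1
    ring
  have hP0 : P (EuclideanSpace.single 0 1) = v := by
    change ∑ k, (EuclideanSpace.single (0 : ZMod p) (1 : ℂ)) k • w k = v
    rw [Finset.sum_eq_single 0 (fun k _ hk => by simp [hk]) (by simp)]
    have := hw 0
    simp only [Int.cast_zero] at this
    rw [this]
    simp [e, V]
  have hker : LinearMap.ker P = ⊥ := by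
    refine (eq_bot_or_eq_top_of_commutant_trivial
      (S := Set.range fun g => (cyclicRep χ ζ g :
        EuclideanSpace ℂ (ZMod p) →L[ℂ] EuclideanSpace ℂ (ZMod p))) ?_ ?_ _ ?_).resolve_right ?_
    · rintro _ ⟨g, rfl⟩
      exact ⟨g⁻¹, by simp only [map_inv]; rfl⟩
    · exact fun T hT => eq_smul_one_of_commute_cyclicRep χ hχ ζ T fun g => hT _ ⟨g, rfl⟩
    · rintro _ ⟨g, rfl⟩ f hf
      rw [LinearMap.mem_ker] at hf ⊢
      rw [← hP, hf, map_zero]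
    · intro h
      rw [LinearMap.ker_eq_top] at h
      rw [h] at hP0
      exact hv0 hP0.symm
  have hrange : LinearMap.range P = ⊤ := by
    refine (hirr _ ?_).resolve_left fun h => ?_
    · rintro g _ ⟨f, rfl⟩
      exact ⟨_, (hP g f).symm⟩
    · rw [LinearMap.range_eq_bot] at h
      rw [h] at hP0
      exact hv0 hP0.symm
  exact ⟨p, inferInstance, χ, ζ, LinearEquiv.ofBijective P
    ⟨LinearMap.ker_eq_bot.1 hker, LinearMap.range_eq_top.1 hrange⟩, hχ, hP⟩

end Classification

/-! ### Representations of a C⋆-algebra generated by unitaries -/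

section StarAlgHom

variable {A : Type*} [Ring A] [StarRing A] [Algebra ℂ A]
  {H : Type*} [NormedAddCommGroup H] [InnerProductSpace ℂ H] [CompleteSpace H]

theorem starAlgHom_add_apply (φ : A →⋆ₐ[ℂ] (H →L[ℂ] H)) (x y : A) (v : H) :
    φ (x + y) v = φ x v + φ y v := by
  rw [map_add]
  rfl

theorem starAlgHom_smul_apply (φ : A →⋆ₐ[ℂ] (H →L[ℂ] H)) (r : ℂ) (x : A) (v : H) :
    φ (r • x) v = r • φ x v := by
  rw [map_smul]
  rfl

/-- The image of a family of unitaries under a representation. -/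
def unitaryRepOfStarAlgHom {G : Type*} [Group G] (u : G → A) (h1 : u 1 = 1)
    (hmul : ∀ g h, u (g * h) = u g * u h) (hstar : ∀ g, star (u g) = u g⁻¹)
    (φ : A →⋆ₐ[ℂ] (H →L[ℂ] H)) : G →* unitary (H →L[ℂ] H) :=
  MonoidHom.mk' (fun g => ⟨φ (u g), Unitary.mem_iff.2 (by
    rw [← map_star, hstar, ← map_mul, ← map_mul, ← hmul, ← hmul,
      inv_mul_cancel, mul_inv_cancel, h1, map_one]
    exact ⟨rfl, rfl⟩)⟩) fun g h => Subtype.ext ((congrArg φ (hmul g h)).trans (map_mul φ _ _))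

end StarAlgHom

/-! ### The space of irreducible traces of `𝒰_a` -/

section Traces

variable {a : Label} {q : ℕ} [NeZero q]

/-- The trace of the cyclic representation. -/
def cyclicTrace (χ : PerDvd q a) (ζ : Circle) (x : U a) : ℂ :=
  LinearMap.trace ℂ _ (integrated (cyclicRep χ ζ) x).toLinearMap

theorem cyclicTrace_eq_sum (χ : PerDvd q a) (ζ : Circle) (x : U a) :
    cyclicTrace χ ζ x = ∑ k, integrated (cyclicRep χ ζ) x (EuclideanSpace.single k 1) k := by
  rw [cyclicTrace, LinearMap.trace_eq_sum_inner _ (EuclideanSpace.basisFun (ZMod q) ℂ)]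
  simp [EuclideanSpace.inner_single_left]

theorem cyclicTrace_canonical (χ : PerDvd q a) (ζ : Circle) (g : G a) :
    cyclicTrace χ ζ (canonical g) = if ((toAdd g.right : ℤ) : ZMod q) = 0 then
      ∑ k : ZMod q, ((ζ ^ toAdd g.right * orb χ.1 k g.left : Circle) : ℂ) else 0 := by
  rw [cyclicTrace_eq_sum]
  split_ifs with h
  · refine Finset.sum_congr rfl fun k _ => ?_
    rw [integrated_canonical, cyclicRep_apply, h, add_zero]
    simp
  · refine Finset.sum_eq_zero fun k _ => ?_
    rw [integrated_canonical, cyclicRep_apply]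
    simp [h]

theorem cyclicTrace_canonical_inl (χ : PerDvd q a) (ζ : Circle) (b : Multiplicative (B a)) :
    cyclicTrace χ ζ (canonical (SemidirectProduct.inl b)) = ∑ k : ZMod q, (orb χ.1 k b : ℂ) := by
  rw [cyclicTrace_canonical]
  simp

theorem isIrreducibleRep_integrated_cyclicRep {χ : PerDvd q a} (hχ : χ.1 ∈ Per q a) (ζ : Circle) :
    IsIrreducibleRep (integrated (cyclicRep χ ζ)) := fun T hT =>
  eq_smul_one_of_commute_cyclicRep χ hχ ζ T fun g => hT (canonical g)

theorem cyclicTrace_mem {χ : PerDvd q a} (hχ : χ.1 ∈ Per q a) (ζ : Circle) :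
    cyclicTrace χ ζ ∈ irreducibleTraces (U a) q :=
  ⟨_, isIrreducibleRep_integrated_cyclicRep hχ ζ, rfl⟩

theorem continuous_starAlgHom_apply {G : Type} [Group G] {H : Type*} [NormedAddCommGroup H]
    [InnerProductSpace ℂ H] [CompleteSpace H] (φ : groupCStar G →⋆ₐ[ℂ] (H →L[ℂ] H)) (v : H) :
    Continuous fun x => φ x v :=
  (ContinuousLinearMap.apply ℂ H v).continuous.comp (continuous_starAlgHom φ)

/-- By density, subspaces invariant under the group are invariant under the algebra, and an
intertwiner for the group intertwines the algebra representations. Dimension forces `p = q`, and the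
trace is invariant under conjugation. -/
theorem exists_eq_cyclicTrace {τ : U a → ℂ} (hτ : τ ∈ irreducibleTraces (U a) q) :
    ∃ χ : PerDvd q a, χ.1 ∈ Per q a ∧ ∃ ζ, τ = cyclicTrace χ ζ := by
  obtain ⟨φ, hφ, rfl⟩ := hτ
  obtain ⟨p, _, χ, ζ, P, hχ, hP⟩ := exists_equiv_cyclicRep
    (unitaryRepOfStarAlgHom (canonical (G := G a)) canonical_one canonical_mul star_canonical φ) fun W hW =>
    hφ.eq_bot_or_eq_top W fun x => by
      induction x using groupCStar_induction with
      | hclosed =>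
        simp only [Set.ofPred_forall]
        exact isClosed_iInter fun w => isClosed_iInter fun _ =>
          W.closed_of_finiteDimensional.preimage (continuous_starAlgHom_apply φ w)
      | hcan g => exact hW g
      | hadd x y hx hy =>
        intro w hw
        rw [starAlgHom_add_apply]
        exact W.add_mem (hx w hw) (hy w hw)
      | hsmul r x hx =>
        intro w hw
        rw [starAlgHom_smul_apply]
        exact W.smul_mem r (hx w hw)
  have hpq : p = q := by
    have := P.finrank_eq
    simpa using this
  subst hpq
  refine ⟨χ, hχ, ζ, funext fun x => ?_⟩
  have hx : ∀ f, φ x (P f) = P (integrated (cyclicRep χ ζ) x f) := by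
    induction x using groupCStar_induction with
    | hclosed =>
      simp only [Set.ofPred_forall]
      exact isClosed_iInter fun f => isClosed_eq (continuous_starAlgHom_apply φ (P f))
        (P.toLinearMap.continuous_of_finiteDimensional.comp
          (continuous_starAlgHom_apply (integrated (cyclicRep χ ζ)) f))
    | hcan g => exact hP g
    | hadd x y hx hy =>
      intro f
      rw [starAlgHom_add_apply, starAlgHom_add_apply, hx, hy, map_add]
    | hsmul r x hx =>
      intro f
      rw [starAlgHom_smul_apply, starAlgHom_smul_apply, hx, map_smul]
  rw [cyclicTrace, ← LinearMap.trace_conj' (integrated (cyclicRep χ ζ) x).toLinearMap P]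
  congr 1
  refine LinearMap.ext fun v => ?_
  obtain ⟨f, rfl⟩ := P.surjective v
  rw [LinearEquiv.conj_apply_apply, LinearEquiv.symm_apply_apply]
  exact hx f

theorem cyclicTrace_add (χ : PerDvd q a) (ζ : Circle) (x y : U a) :
    cyclicTrace χ ζ (x + y) = cyclicTrace χ ζ x + cyclicTrace χ ζ y := by
  simp only [cyclicTrace_eq_sum, starAlgHom_add_apply, PiLp.add_apply, Finset.sum_add_distrib]

theorem cyclicTrace_smul (χ : PerDvd q a) (ζ : Circle) (r : ℂ) (x : U a) :
    cyclicTrace χ ζ (r • x) = r * cyclicTrace χ ζ x := by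
  simp only [cyclicTrace_eq_sum, starAlgHom_smul_apply, PiLp.smul_apply, smul_eq_mul,
    Finset.mul_sum]

theorem continuous_cyclicTrace_apply (χ : PerDvd q a) (ζ : Circle) :
    Continuous (cyclicTrace χ ζ) := by
  rw [show cyclicTrace χ ζ = _ from funext (cyclicTrace_eq_sum χ ζ)]
  exact continuous_finsetSum _ fun k _ =>
    (PiLp.continuous_apply 2 _ k).comp (continuous_starAlgHom_apply _ _)

theorem continuous_cyclicTrace :
    Continuous fun p : PerDvd q a × Circle => cyclicTrace p.1 p.2 := by
  refine continuous_pi fun x => ?_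
  have h : Continuous fun p : PerDvd q a × Circle => integrated (cyclicRep p.1 p.2) x := by
    refine continuous_starAlgHom_family _ (fun g => ?_) x
    simp only [integrated_canonical]
    refine continuous_clm_apply.2 fun f => ?_
    refine (PiLp.continuous_toLp 2 _).comp (continuous_pi fun k => ?_)
    have h1 : Continuous fun p : PerDvd q a × Circle => p.2 ^ toAdd g.right :=
      (continuous_zpow (G := Circle) _).comp continuous_snd
    have h2 : Continuous fun p : PerDvd q a × Circle => orb p.1.1 k g.left := by
      simp only [orb, dualAut_iterate_apply]
      exact (continuous_apply_gen _).comp (continuous_subtype_val.comp continuous_fst)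
    exact (continuous_subtype_val.comp (Continuous.mul (M := Circle) h1 h2)).mul continuous_const
  simp only [cyclicTrace_eq_sum]
  refine continuous_finsetSum _ fun k _ => ?_
  exact (PiLp.continuous_apply 2 _ k).comp (h.clm_apply continuous_const)

end Traces

/-! ### Counting orbits by connected components -/

/-- A finite T1 range is discrete, so `r` is constant on components, and its fibres, being
connected, are exactly the components. -/
theorem card_connectedComponents_eq_ncard_range {X Y : Type*} [TopologicalSpace X]
    [TopologicalSpace Y] [T1Space Y] {r : X → Y} (hr : Continuous r) (hfin : (Set.range r).Finite)
    (hfib : ∀ y, IsPreconnected (r ⁻¹' {y})) :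
    Nat.card (ConnectedComponents X) = (Set.range r).ncard := by
  have : Finite (Set.range r) := hfin
  have hcont : Continuous (Set.rangeFactorization r) := hr.subtype_mk _
  rw [← Nat.card_coe_set_eq]
  refine Nat.card_congr (Equiv.ofBijective hcont.connectedComponentsLift ⟨?_, ?_⟩)
  · intro c c' h
    obtain ⟨x, rfl⟩ := ConnectedComponents.surjective_coe c
    obtain ⟨y, rfl⟩ := ConnectedComponents.surjective_coe c'
    rw [Continuous.connectedComponentsLift_apply_coe,
      Continuous.connectedComponentsLift_apply_coe] at h
    rw [ConnectedComponents.coe_eq_coe']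
    exact (hfib (r y)).subset_connectedComponent rfl (congrArg Subtype.val h)
  · rintro ⟨_, x, rfl⟩
    exact ⟨x, rfl⟩

section Counting

variable {a : Label} {q : ℕ}

theorem iterate_mem_Per {χ : dualGroup a} (h : χ ∈ Per q a) (j : ℕ) :
    (dualAut a)^[j] χ ∈ Per q a := by
  have hcomm : ∀ k, (dualAut a)^[k] ((dualAut a)^[j] χ) = (dualAut a)^[j] ((dualAut a)^[k] χ) :=
    fun k => by rw [← Function.iterate_add_apply, add_comm, Function.iterate_add_apply]
  refine ⟨fun k hk hkq hk' => h.1 k hk hkq ?_, ?_⟩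
  · rw [hcomm] at hk'
    exact (dualAut a).injective.iterate j hk'
  · rw [hcomm, h.2]

theorem orb_mem_Per {χ : dualGroup a} (h : χ ∈ Per q a) (k : ZMod q) : orb χ k ∈ Per q a :=
  iterate_mem_Per h _

variable [NeZero q]

theorem orb_orb {χ : dualGroup a} (h : χ ∈ Per q a) (k l : ZMod q) :
    orb (orb χ k) l = orb χ (k + l) := by
  refine PontryaginDual.ext fun b => ?_
  obtain ⟨l, rfl⟩ := ZMod.intCast_surjective l
  rw [orb_intCast (orb_mem_Per h k).2, orb_action h.2]

/-- The sum of the characters of an orbit, the restriction of the cyclic trace to `B_a`. -/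
def orbitSum (q : ℕ) [NeZero q] (χ : dualGroup a) (b : Multiplicative (B a)) : ℂ :=
  ∑ k : ZMod q, (orb χ k b : ℂ)

/-- Distinct characters are linearly independent, so the coefficients of `χ'` in the two sums agree,
and in its own orbit sum this coefficient is nonzero. -/
theorem exists_eq_orb_of_orbitSum_eq {χ χ' : dualGroup a} (h : orbitSum q χ = orbitSum q χ') :
    ∃ k : ZMod q, χ' = orb χ k := by
  classical
  let F : dualGroup a → (Multiplicative (B a) →* ℂ) := fun ψ =>
    (Circle.coeHom).comp (ψ : Multiplicative (B a) →* Circle)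
  have hF : Function.Injective F := fun ψ ψ' hψ =>
    PontryaginDual.ext fun b => Circle.ext (DFunLike.congr_fun hψ b)
  have hli := linearIndependent_monoidHom (Multiplicative (B a)) ℂ
  have hsum : ∀ ψ : dualGroup a, Finsupp.linearCombination ℂ
      (fun f : Multiplicative (B a) →* ℂ => (f : Multiplicative (B a) → ℂ))
      (∑ k : ZMod q, Finsupp.single (F (orb ψ k)) 1) = orbitSum q ψ := fun ψ => by
    ext b
    simp [map_sum, orbitSum, F]
    rfl
  have heq := hli ((hsum χ).trans (h.trans (hsum χ').symm))
  have hval := DFunLike.congr_fun heq (F χ')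
  simp only [Finsupp.finsetSum_apply, Finsupp.single_apply, hF.eq_iff, Finset.sum_boole] at hval
  have hpos : (Finset.univ.filter fun k : ZMod q => orb χ' k = χ').card ≠ 0 :=
    Finset.card_ne_zero_of_mem (a := 0) (by simp [orb_zero])
  rw [Nat.cast_inj] at hval
  rw [← hval] at hpos
  obtain ⟨k, hk⟩ := Finset.card_ne_zero.1 hpos
  exact ⟨k, (Finset.mem_filter.1 hk).2.symm⟩

theorem orbitSum_orb {χ : dualGroup a} (h : χ ∈ Per q a) (k : ZMod q) :
    orbitSum q (orb χ k) = orbitSum q χ := by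
  ext b
  simp only [orbitSum, orb_orb h]
  exact Equiv.sum_comp (Equiv.addLeft k) fun l => (orb χ l b : ℂ)

theorem cyclicTrace_congr {χ χ' : PerDvd q a} (h : orbitSum q χ.1 = orbitSum q χ'.1) (ζ : Circle) :
    cyclicTrace χ ζ = cyclicTrace χ' ζ := by
  funext x
  induction x using groupCStar_induction with
  | hclosed =>
    exact isClosed_eq (continuous_cyclicTrace_apply χ ζ) (continuous_cyclicTrace_apply χ' ζ)
  | hcan g =>
    rw [cyclicTrace_canonical, cyclicTrace_canonical]
    have := congrFun h g.left
    simp only [orbitSum] at this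
    simp only [Circle.coe_mul, ← Finset.mul_sum, this]
  | hadd x y hx hy => rw [cyclicTrace_add, cyclicTrace_add, hx, hy]
  | hsmul r x hx => rw [cyclicTrace_smul, cyclicTrace_smul, hx]

/-- Each fibre of `orbitSum` on these points is one orbit, with `q` elements. -/
theorem ncard_Per_eq_mul (hfin : (Per q a).Finite) :
    (Per q a).ncard = (orbitSum q '' Per q a).ncard * q := by
  classical
  have hS := hfin.image (orbitSum q)
  rw [Set.ncard_eq_toFinset_card _ hfin, Set.ncard_eq_toFinset_card _ hS,
    Finset.card_eq_sum_card_fiberwise (f := orbitSum q) (t := hS.toFinset)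
      (fun χ hχ => by simpa using ⟨χ, by simpa using hχ, rfl⟩)]
  refine Finset.sum_const_nat fun s hs => ?_
  obtain ⟨χ, hχ, rfl⟩ := hS.mem_toFinset.1 hs
  have : hfin.toFinset.filter (fun ψ => orbitSum q ψ = orbitSum q χ)
      = Finset.univ.image fun k : ZMod q => orb χ k := by
    ext ψ
    simp only [Finset.mem_filter, Set.Finite.mem_toFinset, Finset.mem_image, Finset.mem_univ,
      true_and]
    constructor
    · rintro ⟨_, h⟩
      obtain ⟨k, hk⟩ := exists_eq_orb_of_orbitSum_eq h.symm
      exact ⟨k, hk.symm⟩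
    · rintro ⟨k, rfl⟩
      exact ⟨orb_mem_Per hχ k, orbitSum_orb hχ k⟩
  rw [this, Finset.card_image_of_injective _ (orb_injective hχ), Finset.card_univ, ZMod.card]

/-- The number of points of exact period `q` is read off from the space of irreducible traces. -/
theorem ncard_Per_eq_card_connectedComponents (hfin : (Per q a).Finite) :
    (Per q a).ncard = Nat.card (ConnectedComponents (irreducibleTraces (U a) q)) * q := by
  let r : irreducibleTraces (U a) q → Multiplicative (B a) → ℂ :=
    fun τ b => τ.1 (canonical (SemidirectProduct.inl b))
  have hr : Continuous r :=
    continuous_pi fun b => (continuous_apply _).comp continuous_subtype_val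
  have hrc : ∀ (χ : PerDvd q a) (hχ : χ.1 ∈ Per q a) ζ,
      r ⟨cyclicTrace χ ζ, cyclicTrace_mem hχ ζ⟩ = orbitSum q χ.1 := fun χ hχ ζ =>
    funext fun b => cyclicTrace_canonical_inl χ ζ b
  have hrange : Set.range r = orbitSum q '' Per q a := by
    ext s
    constructor
    · rintro ⟨⟨τ, hτ⟩, rfl⟩
      obtain ⟨χ, hχ, ζ, rfl⟩ := exists_eq_cyclicTrace hτ
      exact ⟨χ.1, hχ, (hrc χ hχ ζ).symm⟩
    · rintro ⟨χ, hχ, rfl⟩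
      exact ⟨⟨cyclicTrace ⟨χ, hχ.2⟩ 1, cyclicTrace_mem hχ 1⟩, hrc ⟨χ, hχ.2⟩ hχ 1⟩
  rw [ncard_Per_eq_mul hfin, ← hrange, card_connectedComponents_eq_ncard_range hr
    (hrange ▸ hfin.image _)]
  intro s
  by_cases hs : s ∈ Set.range r
  · rw [hrange] at hs
    obtain ⟨χ, hχ, rfl⟩ := hs
    let c : Circle → irreducibleTraces (U a) q := fun ζ =>
      ⟨cyclicTrace ⟨χ, hχ.2⟩ ζ, cyclicTrace_mem hχ ζ⟩
    have hc : Continuous c :=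
      (continuous_cyclicTrace.comp (Continuous.prodMk_right _)).subtype_mk _
    -- Traces with the same orbit sum differ only in the phase, so the fibre is a continuous image
    -- of the circle.
    have : r ⁻¹' {orbitSum q χ} = Set.range c := by
      ext ⟨τ, hτ⟩
      constructor
      · intro h
        obtain ⟨χ', hχ', ζ, rfl⟩ := exists_eq_cyclicTrace hτ
        refine ⟨ζ, Subtype.ext (cyclicTrace_congr ?_ ζ)⟩
        rw [← hrc χ' hχ' ζ]
        exact h.symm
      · rintro ⟨ζ, h⟩
        rw [← h]
        exact hrc ⟨χ, hχ.2⟩ hχ ζ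
    rw [this]
    exact isPreconnected_range hc
  · rw [Set.preimage_singleton_eq_empty.2 hs]
    exact isPreconnected_empty

end Counting

/-! ### Periodic points by exact period -/

theorem mem_Per_iff_minimalPeriod {a : Label} {q : ℕ} (hq : 0 < q) {χ : dualGroup a} :
    χ ∈ Per q a ↔ Function.minimalPeriod (dualAut a) χ = q := by
  constructor
  · rintro ⟨h1, h2⟩
    have hp : Function.IsPeriodicPt (dualAut a) q χ := h2
    refine (hp.minimalPeriod_le hq).eq_of_not_lt fun hlt => ?_
    exact h1 _ (hp.minimalPeriod_pos hq) hlt (Function.isPeriodicPt_minimalPeriod _ _)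
  · rintro rfl
    refine ⟨fun k hk hkq => ?_, Function.isPeriodicPt_minimalPeriod _ _⟩
    exact Function.not_isPeriodicPt_of_pos_of_lt_minimalPeriod hk.ne' hkq

theorem ncard_PerDvd_eq_sum {a : Label} {q : ℕ} (hq : 0 < q) (hfin : (PerDvd q a).Finite) :
    (PerDvd q a).ncard = ∑ d ∈ q.divisors, (Per d a).ncard := by
  classical
  rw [Set.ncard_eq_toFinset_card _ hfin, Finset.card_eq_sum_card_fiberwise
    (f := Function.minimalPeriod (dualAut a)) (t := q.divisors) fun χ hχ => ?_]
  · refine Finset.sum_congr rfl fun d hd => ?_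
    rw [← Set.ncard_coe_finset]
    congr 1
    ext χ
    rw [mem_Per_iff_minimalPeriod (Nat.pos_of_mem_divisors hd), Finset.mem_coe, Finset.mem_filter,
      Set.Finite.mem_toFinset, and_iff_right_iff_imp]
    rintro rfl
    exact Function.isPeriodicPt_iff_minimalPeriod_dvd.2 (Nat.dvd_of_mem_divisors hd)
  · have hχ' : χ ∈ PerDvd q a := by simpa using hχ
    exact Nat.mem_divisors.2 ⟨Function.isPeriodicPt_iff_minimalPeriod_dvd.1 hχ', hq.ne'⟩

/-! ### Isomorphism invariance for algebraic labels -/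

theorem ncard_Per_eq_of_equiv {a a' : Label} (e : U a ≃⋆ₐ[ℂ] U a') {q : ℕ} (hq : 0 < q)
    (hfin : (Per q a).Finite) (hfin' : (Per q a').Finite) :
    (Per q a).ncard = (Per q a').ncard := by
  have : NeZero q := ⟨hq.ne'⟩
  rw [ncard_Per_eq_card_connectedComponents hfin, ncard_Per_eq_card_connectedComponents hfin']
  congr 1
  have E := irreducibleTracesHomeomorph e q
  refine Nat.card_congr
    ⟨E.continuous.connectedComponentsMap, E.symm.continuous.connectedComponentsMap, ?_, ?_⟩
  · intro c
    obtain ⟨x, rfl⟩ := ConnectedComponents.surjective_coe c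
    exact congrArg _ (E.symm_apply_apply x)
  · intro c
    obtain ⟨x, rfl⟩ := ConnectedComponents.surjective_coe c
    exact congrArg _ (E.apply_symm_apply x)

theorem invariants_eq_of_isDefining {a a' : Label} (e : U a ≃⋆ₐ[ℂ] U a') {f f' : ℤ[X]}
    (hf : IsDefining a f) (hf' : IsDefining a' f') :
    (∀ q : ℕ, 0 < q → (Per q a).encard = (Per q a').encard ∧
      (PerDvd q a).encard = (PerDvd q a').encard) ∧ entropy a = entropy a' := by
  have h1 : ∀ q : ℕ, 0 < q → (Per q a).ncard = (Per q a').ncard := fun q hq =>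
    ncard_Per_eq_of_equiv e hq ((hf.finite_PerDvd hq).subset (Per_subset_PerDvd q a))
      ((hf'.finite_PerDvd hq).subset (Per_subset_PerDvd q a'))
  have h2 : ∀ q : ℕ, 0 < q → (PerDvd q a).encard = (PerDvd q a').encard := fun q hq => by
    rw [← (hf.finite_PerDvd hq).cast_ncard_eq, ← (hf'.finite_PerDvd hq).cast_ncard_eq,
      ncard_PerDvd_eq_sum hq (hf.finite_PerDvd hq), ncard_PerDvd_eq_sum hq (hf'.finite_PerDvd hq),
      Finset.sum_congr rfl fun d hd => h1 d (Nat.pos_of_mem_divisors hd)]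
  refine ⟨fun q hq => ⟨?_, h2 q hq⟩, ?_⟩
  · rw [← ((hf.finite_PerDvd hq).subset (Per_subset_PerDvd q a)).cast_ncard_eq,
      ← ((hf'.finite_PerDvd hq).subset (Per_subset_PerDvd q a')).cast_ncard_eq, h1 q hq]
  · rw [hf.entropy_eq_expGrowthSup, hf'.entropy_eq_expGrowthSup]
    refine ExpGrowth.expGrowthSup_congr ?_
    filter_upwards [Filter.eventually_gt_atTop 0] with n hn
    rw [h2 n hn]

/-! ### Transcendental labels -/

section Transcendental

variable {a : Label}

theorem eq_zero_of_evalHom_eq_zero (h : Transcendental ℤ (a : ℝ)) {m : ℤ →₀ ℤ}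
    (hm : evalHom a m = 0) : m = 0 := by
  obtain ⟨N, hN⟩ := exists_polynomial_of_finsupp m
  obtain ⟨g, hg⟩ := hN N le_rfl
  have h0 := hg fun k => (a : ℝ) ^ k
  rw [(evalHom_eq_zero_iff a m).1 hm, aeval_shift_zpow a.2.ne', eq_comm,
    mul_eq_zero_iff_left (zpow_ne_zero _ a.2.ne')] at h0
  obtain rfl : g = 0 := by
    by_contra hne
    exact h ⟨g, hne, h0⟩
  ext k
  -- With `g = 0` the identity holds for every sequence; the indicator of `k` extracts the `k`-th
  -- coefficient.
  have hk := hg (Pi.single k 1)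
  rw [map_zero, LinearMap.zero_apply, Pi.zero_apply, Finsupp.sum_eq_single k
    (fun j _ hj => by simp [hj]) (by simp)] at hk
  simpa using hk

theorem coords_surjective (h : Transcendental ℤ (a : ℝ)) : Function.Surjective (coords a) :=
  fun x => by
    obtain ⟨χ, hχ⟩ := exists_dual_of_forall_prod_eq_one (a := a) x fun m hm => by
      rw [eq_zero_of_evalHom_eq_zero h hm, Finsupp.prod_zero_index]
    exact ⟨χ, funext hχ⟩

/-- For transcendental `a` the dual of `B_a` is the full shift over the circle. -/
def coordsHomeomorph (h : Transcendental ℤ (a : ℝ)) : dualGroup a ≃ₜ (ℤ → Circle) :=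
  (isClosedEmbedding_coords a).isEmbedding.toHomeomorphOfSurjective (coords_surjective h)

theorem coordsHomeomorph_apply (h : Transcendental ℤ (a : ℝ)) (χ : dualGroup a) (k : ℤ) :
    coordsHomeomorph h χ k = χ (gen a k) := rfl

theorem coordsHomeomorph_symm_apply_gen (h : Transcendental ℤ (a : ℝ)) (x : ℤ → Circle) (k : ℤ) :
    (coordsHomeomorph h).symm x (gen a k) = x k := by
  rw [← coordsHomeomorph_apply h, Homeomorph.apply_symm_apply]

end Transcendental

theorem exists_homeomorph_semiconj {a a' : Label} (h : Transcendental ℤ (a : ℝ))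
    (h' : Transcendental ℤ (a' : ℝ)) :
    ∃ φ : dualGroup a ≃ₜ dualGroup a', Function.Semiconj φ (dualAut a) (dualAut a') := by
  refine ⟨(coordsHomeomorph h).trans (coordsHomeomorph h').symm, fun χ => dual_ext_gen fun k => ?_⟩
  simp only [Homeomorph.trans_apply, coordsHomeomorph_symm_apply_gen, coordsHomeomorph_apply,
    dualAut_apply, mulAut_gen]

theorem entropy_le_of_semiconj {a a' : Label} (φ : dualGroup a ≃ₜ dualGroup a')
    (h : Function.Semiconj φ (dualAut a) (dualAut a')) : entropy a' ≤ entropy a := by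
  rw [entropy_eq, entropy_eq, ← φ.surjective.range_eq, ← Set.image_univ]
  exact Dynamics.coverEntropy_image_le_of_uniformContinuous h
    (CompactSpace.uniformContinuous_of_continuous φ.continuous) _

theorem invariants_eq_of_semiconj {a a' : Label} (φ : dualGroup a ≃ₜ dualGroup a')
    (h : Function.Semiconj φ (dualAut a) (dualAut a')) :
    (∀ q : ℕ, 0 < q → (Per q a).encard = (Per q a').encard ∧
      (PerDvd q a).encard = (PerDvd q a').encard) ∧ entropy a = entropy a' := by
  have hiter : ∀ (k : ℕ) (χ : dualGroup a), (dualAut a')^[k] (φ χ) = φ χ ↔ (dualAut a)^[k] χ = χ :=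
    fun k χ => by rw [← (h.iterate_right k).eq, φ.injective.eq_iff]
  have himg : ∀ {S : Set (dualGroup a)} {S' : Set (dualGroup a')}, (∀ χ, φ χ ∈ S' ↔ χ ∈ S) →
      S.encard = S'.encard := fun {S S'} hS => by
    rw [← φ.injective.encard_image, ← Set.image_preimage_eq S' φ.surjective]
    congr 2
    ext χ
    exact (hS χ).symm
  refine ⟨fun q _ => ⟨himg fun χ => ?_, himg fun χ => hiter q χ⟩, ?_⟩
  · simp only [Per, Set.mem_ofPred_eq, ne_eq, hiter]
  · refine le_antisymm (entropy_le_of_semiconj φ.symm fun χ => ?_) (entropy_le_of_semiconj φ h)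
    rw [φ.symm_apply_eq, h.eq, φ.apply_symm_apply]

/-! ### Separating algebraic from transcendental labels -/

open scoped ComplexOrder in
-- Cutting the circle at `f 0` gives an injective function `g` to the line, continuous on the
-- punctured plane. The plane stays connected after removing countably many points, which
-- contradicts the intermediate value property.
theorem not_injective_of_continuous_circle {f : ℝ × ℝ → Circle} (hf : Continuous f) :
    ¬ Function.Injective f := by
  intro hinj
  have hrank : 1 < Module.rank ℝ (ℝ × ℝ) := by
    rw [rank_prod', Module.rank_self, one_add_one_eq_two]
    exact Nat.one_lt_ofNat
  have hconn : ∀ s : Set (ℝ × ℝ), s.Countable → IsPreconnected sᶜ := fun s hs =>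
    (hs.isPathConnected_compl_of_one_lt_rank hrank).isConnected.isPreconnected
  set g : ℝ × ℝ → ℝ := fun p => Complex.arg (-(f p / f 0 : Circle)) with hg
  have hslit : ∀ p, p ≠ 0 → (-(f p / f 0 : Circle) : ℂ) ∈ Complex.slitPlane := by
    intro p hp
    rw [Complex.mem_slitPlane_iff_not_le_zero, neg_nonpos]
    intro hle
    have h1 : ((f p / f 0 : Circle) : ℂ) = 1 := by
      have h2 := RCLike.norm_of_nonneg' hle
      rw [Circle.norm_coe] at h2
      rw [← h2]
      exact Complex.ofReal_one
    exact hp (hinj (div_eq_one.1 (Circle.ext h1)))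
  have hgc : ContinuousOn g {0}ᶜ := fun p hp =>
    ((Complex.continuousAt_arg (hslit p hp)).comp (f := fun p => (-(f p / f 0 : Circle) : ℂ))
      (continuous_subtype_val.comp (hf.div' continuous_const)).neg.continuousAt).continuousWithinAt
  have hginj : ∀ p p', g p = g p' → p = p' := by
    intro p p' h
    have h1 : (-(f p / f 0 : Circle) : ℂ) = -(f p' / f 0 : Circle) :=
      Complex.ext_norm_arg (by rw [norm_neg, norm_neg, Circle.norm_coe, Circle.norm_coe]) h
    exact hinj (div_left_injective (Circle.ext (neg_injective h1)))
  have key : ∀ p p', p ≠ 0 → p' ≠ 0 → ¬ g p < g p' := by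
    intro p p' hp hp' hlt
    obtain ⟨r, hr0, hr⟩ := (hconn {0} (Set.countable_singleton _)).intermediate_value
      hp hp' hgc (⟨by linarith, by linarith⟩ : (g p + g p') / 2 ∈ Set.Icc (g p) (g p'))
    have hrp : p ≠ r := by rintro rfl; linarith
    have hrp' : p' ≠ r := by rintro rfl; linarith
    -- With the point `r` removed as well, the same midpoint value is still attained, against
    -- injectivity.
    obtain ⟨s, hs0, hs⟩ := (hconn {0, r} (Set.to_countable _)).intermediate_value
      (by simp [hp, hrp]) (by simp [hp', hrp'])
      (hgc.mono (Set.compl_subset_compl.2 (by simp)))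
      (⟨by linarith, by linarith⟩ : (g p + g p') / 2 ∈ Set.Icc (g p) (g p'))
    obtain rfl := hginj s r (hs.trans hr.symm)
    simp at hs0
  have h1 : ((1, 0) : ℝ × ℝ) ≠ 0 := by simp
  have h2 : ((2, 0) : ℝ × ℝ) ≠ 0 := by simp
  have h12 := hginj _ _ (le_antisymm (not_lt.1 (key _ _ h2 h1)) (not_lt.1 (key _ _ h1 h2)))
  simp at h12

theorem injective_circle_exp_arctan : Function.Injective fun t : ℝ => Circle.exp (Real.arctan t) := by
  intro s t h
  have harg : ∀ t : ℝ, Complex.arg (Circle.exp (Real.arctan t)) = Real.arctan t := fun t =>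
    Circle.arg_exp (by linarith [Real.neg_pi_div_two_lt_arctan t, Real.pi_pos])
      (by linarith [Real.arctan_lt_pi_div_two t, Real.pi_pos])
  refine Real.arctan_injective ?_
  rw [← harg s, ← harg t]
  exact congrArg (fun z : Circle => Complex.arg z) h

section OneDimensional

variable {a : Label}

theorem cyclicTrace_one_canonical_inl (χ : PerDvd 1 a) (ζ : Circle) (b : Multiplicative (B a)) :
    cyclicTrace χ ζ (canonical (SemidirectProduct.inl b)) = (χ.1 b : ℂ) := by
  rw [cyclicTrace_canonical_inl, Fintype.sum_unique]
  exact congrArg _ (DFunLike.congr_fun (orb_zero χ.1) b)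

theorem cyclicTrace_one_canonical_inr (χ : PerDvd 1 a) (ζ : Circle) :
    cyclicTrace χ ζ (canonical (SemidirectProduct.inr (ofAdd 1))) = (ζ : ℂ) := by
  rw [cyclicTrace_canonical, if_pos (Subsingleton.elim _ _), Fintype.sum_unique]
  simp

theorem PerDvd_one_subset_Per : PerDvd 1 a ⊆ Per 1 a := fun _ h =>
  ⟨fun _ h0 h1 => absurd h0 (by omega), h⟩

/-- Every constant sequence is a fixed point of the full shift, so fixed point and phase vary over
two independent circles. The trace recovers them at `gen a 0` and at the generator of `ℤ`; `arctan`
embeds the line in each circle. -/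
theorem exists_continuous_injective_irreducibleTraces (h : Transcendental ℤ (a : ℝ)) :
    ∃ F : ℝ × ℝ → irreducibleTraces (U a) 1, Continuous F ∧ Function.Injective F := by
  have hmem : ∀ w : Circle, (coordsHomeomorph h).symm (fun _ => w) ∈ PerDvd 1 a := fun w =>
    mem_PerDvd_iff.2 fun k => by
      rw [coordsHomeomorph_symm_apply_gen, coordsHomeomorph_symm_apply_gen]
  let X : ℝ × ℝ → PerDvd 1 a × Circle := fun p =>
    (⟨_, hmem (Circle.exp (Real.arctan p.1))⟩, Circle.exp (Real.arctan p.2))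
  have hexp : Continuous fun t : ℝ => Circle.exp (Real.arctan t) :=
    Circle.exp.continuous.comp Real.continuous_arctan
  have hX : Continuous X :=
    (((coordsHomeomorph h).symm.continuous.comp
      (continuous_pi fun _ => hexp.comp continuous_fst)).subtype_mk _).prodMk
      (hexp.comp continuous_snd)
  refine ⟨fun p => ⟨cyclicTrace (X p).1 (X p).2, cyclicTrace_mem
    (PerDvd_one_subset_Per (X p).1.2) _⟩, (continuous_cyclicTrace.comp hX).subtype_mk _, ?_⟩
  intro p p' hpp
  have hτ : cyclicTrace (X p).1 (X p).2 = cyclicTrace (X p').1 (X p').2 := congrArg Subtype.val hpp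
  have h1 := congrFun hτ (canonical (SemidirectProduct.inl (gen a 0)))
  have h2 := congrFun hτ (canonical (SemidirectProduct.inr (ofAdd 1)))
  rw [cyclicTrace_one_canonical_inl, cyclicTrace_one_canonical_inl] at h1
  rw [cyclicTrace_one_canonical_inr, cyclicTrace_one_canonical_inr] at h2
  have h1' := Circle.ext h1
  simp only [X, coordsHomeomorph_symm_apply_gen] at h1'
  exact Prod.ext (injective_circle_exp_arctan h1') (injective_circle_exp_arctan (Circle.ext h2))

/-- The orbit sum takes finitely many values and varies continuously over the connected plane, so it
is constant. The trace then depends on the phase alone, and the phase is a continuous map from the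
plane to the circle. -/
theorem not_injective_irreducibleTraces (hfin : (PerDvd 1 a).Finite)
    {F : ℝ × ℝ → irreducibleTraces (U a) 1} (hF : Continuous F) : ¬ Function.Injective F := by
  intro hinj
  have hev : ∀ x : U a, Continuous fun p => (F p).1 x := fun x =>
    (continuous_apply x).comp (continuous_subtype_val.comp hF)
  choose χ _ ζ hτ using fun p => exists_eq_cyclicTrace (F p).2
  have hconst : ∀ p p', orbitSum 1 (χ p).1 = orbitSum 1 (χ p').1 := by
    have hr : ∀ p, orbitSum 1 (χ p).1 = fun b => (F p).1 (canonical (SemidirectProduct.inl b)) :=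
      fun p => funext fun b => by rw [hτ p, cyclicTrace_canonical_inl]; rfl
    have hc : Continuous fun p => orbitSum 1 (χ p).1 := by
      simp only [hr]
      exact continuous_pi fun b => hev _
    have hsub : (Set.range fun p => orbitSum 1 (χ p).1).Finite :=
      (hfin.image (orbitSum 1)).subset (by rintro _ ⟨p, rfl⟩; exact ⟨(χ p).1, (χ p).2, rfl⟩)
    intro p p'
    by_contra hne
    exact (isPreconnected_range hc).infinite_of_nontrivial ⟨_, ⟨p, rfl⟩, _, ⟨p', rfl⟩, hne⟩ hsub
  have hζ : ∀ p, (F p).1 (canonical (SemidirectProduct.inr (ofAdd 1))) = (ζ p : ℂ) := fun p => by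
    rw [hτ p, cyclicTrace_one_canonical_inr]
  refine not_injective_of_continuous_circle (f := ζ) ?_ fun p p' h => hinj (Subtype.ext ?_)
  · refine Topology.IsInducing.subtypeVal.continuous_iff.2 ?_
    exact (hev _).congr hζ
  · rw [hτ p, hτ p', h, cyclicTrace_congr (hconst p p')]

end OneDimensional

theorem not_transcendental_of_isDefining {a a' : Label} (e : U a ≃⋆ₐ[ℂ] U a') {f : ℤ[X]}
    (hf : IsDefining a' f) : ¬ Transcendental ℤ (a : ℝ) := fun h => by
  obtain ⟨F, hF, hinj⟩ := exists_continuous_injective_irreducibleTraces h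
  have E := irreducibleTracesHomeomorph e 1
  exact not_injective_irreducibleTraces (hf.finite_PerDvd one_pos) (E.continuous.comp hF)
    (E.injective.comp hinj)

end KappaMinkowski

end

theorem theorem3p3 (a a' : {x : ℝ // 0 < x}) (ha : (a : ℝ) ≠ 1) (ha' : (a' : ℝ) ≠ 1)
    (hU : Nonempty (KappaMinkowski.U a ≃⋆ₐ[ℂ] KappaMinkowski.U a')) :
    (∀ q : ℕ, 0 < q →
      (KappaMinkowski.Per q a).encard = (KappaMinkowski.Per q a').encard ∧
      (KappaMinkowski.PerDvd q a).encard = (KappaMinkowski.PerDvd q a').encard) ∧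
    KappaMinkowski.entropy a = KappaMinkowski.entropy a' := by
  obtain ⟨e⟩ := hU
  by_cases h : IsAlgebraic ℤ (a : ℝ)
  · obtain ⟨f, hf⟩ := KappaMinkowski.exists_isDefining ha h
    by_cases h' : IsAlgebraic ℤ (a' : ℝ)
    · obtain ⟨f', hf'⟩ := KappaMinkowski.exists_isDefining ha' h'
      exact KappaMinkowski.invariants_eq_of_isDefining e hf hf'
    · exact absurd h' (KappaMinkowski.not_transcendental_of_isDefining e.symm hf)
  · by_cases h' : IsAlgebraic ℤ (a' : ℝ)
    · obtain ⟨f', hf'⟩ := KappaMinkowski.exists_isDefining ha' h'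
      exact absurd h (KappaMinkowski.not_transcendental_of_isDefining e hf')
    · obtain ⟨φ, hφ⟩ := KappaMinkowski.exists_homeomorph_semiconj h h'
      exact KappaMinkowski.invariants_eq_of_semiconj φ hφ
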